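/- Let $\|\cdot\|$ be the Euclidean norm. An \emph{extension} of a finite multiset $P\subset\mathbb R^d$ is a multiset $P'\subset\mathbb R^{d+1}$ obtained by appending to every copy of every point $p\in P$ a real last coordinate $p'$ (different copies of the same point may get different values). For a finite multiset $X\subset\mathbb R^{d+1}$ let $\mu^z_0(X)$ be any minimizer of $s\mapsto\sum_{x\in X}\|x-s\|^z$ over all $s\in\mathbb R^{d+1}$ with last coordinate $0$. There are an absolute constant $A$ and one deterministic real-RAM algorithm (exact real arithmetic $+,-,\times,/,\sqrt{\cdot}$ and comparisons, and arithmetic and addressing on natural numbers, at unit cost) such that the following holds for all integers $T\ge 2$, $d\ge 0$, $z\ge 1$, all real $0<\varepsilon<1$, and every finite multiset $P\subset\mathbb R^d$ with at most $T$ distinct points. Given $d$, $z$, $\varepsilon$ and the list of the distinct points of $P$, the algorithm outputs within $(d+1)\cdot T^{A^z\varepsilon^{-2}}$ steps a finite set $\mathcal N\subset\mathbb R^d$ with $$|\mathcal N|\le T^{A^z\varepsilon^{-2}}$$ (so, for fixed $z$, size $T^{O(\varepsilon^{-2})}$ and time $O(d)\cdot T^{O(\varepsilon^{-2})}$) such that: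 for every $m$ and every linear map $\Pi:\mathbb R^d\to\mathbb R^m$ with $$(1-\varepsilon/z)\|x-y\|\le\|\Pi x-\Pi y\|\le(1+\varepsilon/z)\|x-y\|\qquad\text{for all }x,y\in\mathcal N,$$ for every extension $P'$ of $P$ and every sub-multiset $C'\subseteq P'$, writing $\Pi'(C')$ for the multiset of all $(\Pi p,p')$ with $(p,p')\in C'$, the minimizers $\mu_0^z(C')$ and $\mu_0^z(\Pi'(C'))$ exist and, for every choice of them, $$(1-2\varepsilon)\sum_{(p,p')\in C'}\bigl\|(p,p')-\mu^z_0(C')\bigr\|^z\;\le\;\sum_{(p,p')\in C'}\bigl\|(\Pi p,p')-\mu^z_0(\Pi'(C'))\bigr\|^z\;\le\;(1+2\varepsilon)\sum_{(p,p')\in C'}\bigl\|(p,p')-\mu^z_0(C')\bigr\|^z .$$ -/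

import Mathlib

/-! ## A real RAM: structured programs with unit-cost arithmetic -/

namespace RealRAM

/-- A memory: countably many arrays of natural numbers (used for counting and addressing) and
countably many arrays of exact real numbers. -/
structure Mem where
  nat : ℕ → ℕ → ℕ
  real : ℕ → ℕ → ℝ

/-- Expressions with natural values. `load a i` reads cell `i` of the array number `a`;
`sub` is truncated subtraction. -/
inductive NExp where
  | const (n : ℕ)
  | load (a : ℕ) (i : NExp)
  | add (e₁ e₂ : NExp)
  | sub (e₁ e₂ : NExp)
  | mul (e₁ e₂ : NExp)

/-- Expressions with real values. There are no real constants besides natural numbers.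
Division by zero and square roots of negative numbers return `0`. -/
inductive RExp where
  | ofNat (e : NExp)
  | load (a : ℕ) (i : NExp)
  | add (e₁ e₂ : RExp)
  | sub (e₁ e₂ : RExp)
  | mul (e₁ e₂ : RExp)
  | div (e₁ e₂ : RExp)
  | sqrt (e : RExp)

/-- Tests: strict comparisons of naturals and of reals, negation, conjunction. -/
inductive Test where
  | natLt (e₁ e₂ : NExp)
  | realLt (e₁ e₂ : RExp)
  | not (b : Test)
  | and (b₁ b₂ : Test)

namespace NExp

def eval (s : Mem) : NExp → ℕ
  | const n => n
  | load a i => s.nat a (i.eval s)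
  | add e₁ e₂ => e₁.eval s + e₂.eval s
  | sub e₁ e₂ => e₁.eval s - e₂.eval s
  | mul e₁ e₂ => e₁.eval s * e₂.eval s

/-- Number of elementary operations for evaluating the expression. -/
def time : NExp → ℕ
  | const _ => 1
  | load _ i => i.time + 1
  | add e₁ e₂ => e₁.time + e₂.time + 1
  | sub e₁ e₂ => e₁.time + e₂.time + 1
  | mul e₁ e₂ => e₁.time + e₂.time + 1

end NExp

namespace RExp

noncomputable def eval (s : Mem) : RExp → ℝ
  | ofNat e => (e.eval s : ℝ)
  | load a i => s.real a (i.eval s)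
  | add e₁ e₂ => e₁.eval s + e₂.eval s
  | sub e₁ e₂ => e₁.eval s - e₂.eval s
  | mul e₁ e₂ => e₁.eval s * e₂.eval s
  | div e₁ e₂ => e₁.eval s / e₂.eval s
  | sqrt e => Real.sqrt (e.eval s)

/-- Number of elementary operations for evaluating the expression. -/
def time : RExp → ℕ
  | ofNat e => e.time + 1
  | load _ i => i.time + 1
  | add e₁ e₂ => e₁.time + e₂.time + 1
  | sub e₁ e₂ => e₁.time + e₂.time + 1
  | mul e₁ e₂ => e₁.time + e₂.time + 1
  | div e₁ e₂ => e₁.time + e₂.time + 1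
  | sqrt e => e.time + 1

end RExp

namespace Test

def holds (s : Mem) : Test → Prop
  | natLt e₁ e₂ => e₁.eval s < e₂.eval s
  | realLt e₁ e₂ => e₁.eval s < e₂.eval s
  | not b => ¬ b.holds s
  | and b₁ b₂ => b₁.holds s ∧ b₂.holds s

/-- Number of elementary operations for evaluating the test. -/
def time : Test → ℕ
  | natLt e₁ e₂ => e₁.time + e₂.time + 1
  | realLt e₁ e₂ => e₁.time + e₂.time + 1
  | not b => b.time + 1
  | and b₁ b₂ => b₁.time + b₂.time + 1

end Test

/-- Programs. `setNat a i e` and `setReal a i e` store the value of `e` in cell `i` of the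
natural, respectively real, array number `a`. -/
inductive Prog where
  | skip
  | setNat (a : ℕ) (i : NExp) (e : NExp)
  | setReal (a : ℕ) (i : NExp) (e : RExp)
  | seq (p q : Prog)
  | cond (b : Test) (p q : Prog)
  | loop (b : Test) (p : Prog)

/-- The memory after storing `v` in cell `i` of the natural array `a`. -/
def Mem.writeNat (s : Mem) (a i v : ℕ) : Mem :=
  { s with nat := Function.update s.nat a (Function.update (s.nat a) i v) }

/-- The memory after storing `v` in cell `i` of the real array `a`. -/
def Mem.writeReal (s : Mem) (a i : ℕ) (v : ℝ) : Mem :=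
  { s with real := Function.update s.real a (Function.update (s.real a) i v) }

/-- `Exec p s t s'`: started in memory `s`, the program `p` halts after exactly `t` elementary
steps, in memory `s'`. `loop b p` is "while `b` do `p`". -/
inductive Exec : Prog → Mem → ℕ → Mem → Prop where
  | skip (s : Mem) : Exec .skip s 1 s
  | setNat (s : Mem) (a : ℕ) (i e : NExp) :
      Exec (.setNat a i e) s (i.time + e.time + 1) (s.writeNat a (i.eval s) (e.eval s))
  | setReal (s : Mem) (a : ℕ) (i : NExp) (e : RExp) :
      Exec (.setReal a i e) s (i.time + e.time + 1) (s.writeReal a (i.eval s) (e.eval s))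
  | seq {p q : Prog} {s s₁ s₂ : Mem} {t₁ t₂ : ℕ} :
      Exec p s t₁ s₁ → Exec q s₁ t₂ s₂ → Exec (.seq p q) s (t₁ + t₂) s₂
  | condTrue {b : Test} {p q : Prog} {s s₁ : Mem} {t : ℕ} :
      b.holds s → Exec p s t s₁ → Exec (.cond b p q) s (b.time + t) s₁
  | condFalse {b : Test} {p q : Prog} {s s₁ : Mem} {t : ℕ} :
      ¬ b.holds s → Exec q s t s₁ → Exec (.cond b p q) s (b.time + t) s₁
  | loopFalse {b : Test} {p : Prog} {s : Mem} :
      ¬ b.holds s → Exec (.loop b p) s b.time s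
  | loopTrue {b : Test} {p : Prog} {s s₁ s₂ : Mem} {t₁ t₂ : ℕ} :
      b.holds s → Exec p s t₁ s₁ → Exec (.loop b p) s₁ t₂ s₂ →
      Exec (.loop b p) s (b.time + t₁ + t₂) s₂

end RealRAM

/-! ## Clustering with extension coordinates -/

namespace Clustering

/-- Euclidean space of dimension `d`. -/
abbrev E (d : ℕ) : Type := EuclideanSpace ℝ (Fin d)

/-- Euclidean space of dimension `d + 1`, the last coordinate being the extension coordinate. -/
abbrev EExt (d : ℕ) : Type := WithLp 2 (E d × ℝ)

/-- The point `p` with extension coordinate `h`. -/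
def zext {d : ℕ} (p : E d) (h : ℝ) : EExt d := WithLp.toLp 2 (p, h)

/-- `cost^z(X, {s})`. -/
noncomputable def cost {d : ℕ} (z : ℕ) (X : Multiset (EExt d)) (s : EExt d) : ℝ :=
  (X.map fun x => dist x s ^ z).sum

/-- `s` is an optimal `(1,z)`-center of `X` among the points with extension coordinate `0`
(an element of the argmin that defines `μ₀^z(X)`). -/
def IsCenterZero {d : ℕ} (z : ℕ) (X : Multiset (EExt d)) (s : EExt d) : Prop :=
  s.snd = 0 ∧ ∀ s' : EExt d, s'.snd = 0 → cost z X s ≤ cost z X s'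

/-- `P'` is an extension of the multiset `P`: every point of `P` (with multiplicity) receives an
extension coordinate; copies of the same point may receive different ones. -/
def IsExtension {d : ℕ} (P : Multiset (E d)) (P' : Multiset (EExt d)) : Prop :=
  P'.map (fun x => x.fst) = P

/-- The image of a multiset of extended points under a linear map that acts on the first
coordinates and keeps the extension coordinates. -/
def mapExt {d m : ℕ} (Φ : E d →ₗ[ℝ] E m) (X : Multiset (EExt d)) : Multiset (EExt m) :=
  X.map fun x => zext (Φ x.fst) x.snd

/-- `Φ` preserves the pairwise distances in `N` up to a factor `1 ± δ`. -/
def PreservesDist {d m : ℕ} (Φ : E d →ₗ[ℝ] E m) (N : Set (E d)) (δ : ℝ) : Prop :=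
  ∀ x ∈ N, ∀ y ∈ N,
    (1 - δ) * dist x y ≤ dist (Φ x) (Φ y) ∧ dist (Φ x) (Φ y) ≤ (1 + δ) * dist x y

/-- `L` lists the distinct points of the multiset `P`, each once. -/
def IsListing {d : ℕ} (L : List (E d)) (P : Multiset (E d)) : Prop :=
  L.Nodup ∧ ∀ x, x ∈ L ↔ x ∈ P

/-- The initial memory for the input `(d, z, ε, L)`. Natural array `0` holds `d`, the number of
points of `L`, and `z`; real array `0` holds `ε`; real array `1` holds the points of `L`, the
`j`-th coordinate of the `i`-th point in cell `i * d + j`; every other cell holds `0`. -/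
noncomputable def inputMem {d : ℕ} (z : ℕ) (ε : ℝ) (L : List (E d)) : RealRAM.Mem where
  nat a i :=
    if a = 0 then (if i = 0 then d else if i = 1 then L.length else if i = 2 then z else 0) else 0
  real a i :=
    if a = 0 then (if i = 0 then ε else 0)
    else if a = 1 then
      (if h : i / d < L.length ∧ 0 < d then (L.get ⟨i / d, h.1⟩) ⟨i % d, Nat.mod_lt i h.2⟩ else 0)
    else 0

/-- The set of points that a final memory represents: cell `0` of natural array `1` holds the
number of points, and real array `2` holds the points, the `j`-th coordinate of the `i`-th point
in cell `i * d + j`. -/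
def outputSet (d : ℕ) (s : RealRAM.Mem) : Set (E d) :=
  {x | ∃ i < s.nat 1 0, ∀ j : Fin d, x j = s.real 2 (i * d + j)}

end Clustering

namespace Clustering

/-! ## One-point extension of Lipschitz maps -/

/-! Let `L` be the distinct points and `δ = ε / z`. A center has last coordinate `0`, so its
distance to `(p, h)` is `√(‖p - c‖² + h²)`. If the distances of all `p ∈ L` to one center are at
most `K ≥ 1` times those to another, the costs compare with factor `K ^ z`, whatever the extension
and the sub-multiset (`cost_mapExt_le`, `cost_le_mapExt`). It remains to transfer centers between
the two spaces, uniformly over `L`.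

Lower bound: on `L` the inverse of `Φ` is `(1 - δ)⁻¹`-Lipschitz, so Kirszbraun's one-point extension
(`exists_dist_le_of_forall_dist_le`) pulls the projected center back to a center for the original
points. Only `L ⊆ N` is used.

Upper bound: an arbitrary center cannot be pushed forward, since `Φ` is controlled only on the net
`N`. But `N` contains a point that is almost as close to every `p ∈ L` as the center is, and its
image serves.

The net (`exists_reach_dist_le`): start at the point `s₀ ∈ L` nearest to `c`, and while some `p ∈ L`
is farther from the current point than from `c` by more than `η`, move by `η` towards `p`. Each move
lowers the squared distance to `c` by `η²`. With `η` of order `δ ‖s₀ - c‖` this stops after `O(δ⁻²)`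
moves. The center `c` is unknown, so all sequences of operations are enumerated. The scale is found
without any bound on the spread: if `s₀` itself fails because of `q`, then `‖s₀ - q‖` exceeds `‖s₀ -
c‖` by a factor `O(1 / δ)` at most, and repeated halving of `‖s₀ - q‖` yields `η`. A tree with three
children per node and point of `L`, of depth `O(z² / ε²)`, therefore suffices, and a simple loop
program writes it level by level. -/

/-- The variance identity: it expresses the spread about the barycenter through pairwise distances,
the only data that a Lipschitz hypothesis controls. -/
theorem sum_sum_mul_norm_sub_sq {ι F : Type*} [Fintype ι] [NormedAddCommGroup F]
    [InnerProductSpace ℝ F] (w : ι → ℝ) (hw : ∑ i, w i = 1) (v : ι → F) :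
    ∑ i, ∑ j, w i * w j * ‖v i - v j‖ ^ 2
      = 2 * (∑ i, w i * ‖v i‖ ^ 2 - ‖∑ i, w i • v i‖ ^ 2) := by
  have h1 : ‖∑ i, w i • v i‖ ^ 2 = ∑ i, ∑ j, w i * w j * inner ℝ (v i) (v j) := by
    rw [← real_inner_self_eq_norm_sq, sum_inner]
    refine Finset.sum_congr rfl fun i _ => ?_
    rw [inner_sum]
    refine Finset.sum_congr rfl fun j _ => ?_
    rw [real_inner_smul_left, real_inner_smul_right]; ring
  have h2 : ∑ i, w i * ‖v i‖ ^ 2 = ∑ i, ∑ j, w i * w j * ‖v i‖ ^ 2 := by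
    refine Finset.sum_congr rfl fun i _ => ?_
    rw [← Finset.sum_mul, ← Finset.mul_sum, hw, mul_one]
  have h3 : ∑ i, w i * ‖v i‖ ^ 2 = ∑ i, ∑ j, w i * w j * ‖v j‖ ^ 2 := by
    rw [h2, Finset.sum_comm]
    refine Finset.sum_congr rfl fun i _ => Finset.sum_congr rfl fun j _ => ?_
    ring
  have h4 : ∑ i, ∑ j, w i * w j * ‖v i - v j‖ ^ 2
      = ∑ i, ∑ j, w i * w j * ‖v i‖ ^ 2 + ∑ i, ∑ j, w i * w j * ‖v j‖ ^ 2
        - 2 * ∑ i, ∑ j, w i * w j * inner ℝ (v i) (v j) := by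
    simp only [Finset.mul_sum, ← Finset.sum_add_distrib, ← Finset.sum_sub_distrib]
    refine Finset.sum_congr rfl fun i _ => Finset.sum_congr rfl fun j _ => ?_
    rw [norm_sub_sq_real]; ring
  rw [h4, ← h2, ← h3, ← h1]; ring

/-- A `K`-Lipschitz correspondence between finitely many points of two inner product spaces
extends to one more point. -/
theorem exists_dist_le_of_forall_dist_le {ι F G : Type*} [Fintype ι] [NormedAddCommGroup F]
    [InnerProductSpace ℝ F] [NormedAddCommGroup G] [InnerProductSpace ℝ G]
    (K : ℝ) (hK : 0 ≤ K) (x : ι → F) (y : ι → G)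
    (h : ∀ i j, dist (y i) (y j) ≤ K * dist (x i) (x j)) (a : F) :
    ∃ b : G, ∀ i, dist (y i) b ≤ K * dist (x i) a := by
  classical
  rcases isEmpty_or_nonempty ι with hι | hι
  · exact ⟨0, fun i => isEmptyElim i⟩
  -- For weights `w` with barycenter `b`, `g w` is the `w`-average of `‖y i - b‖² - r i²`. The
  -- barycenter of a maximizer of this concave function is the required point.
  let r : ι → ℝ := fun i => K * dist (x i) a
  let α : ι → ℝ := fun i => ‖y i‖ ^ 2 - r i ^ 2
  let g : (ι → ℝ) → ℝ := fun w => ∑ i, w i * α i - ‖∑ i, w i • y i‖ ^ 2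
  have hg : Continuous g := by fun_prop
  have hne : (stdSimplex ℝ ι).Nonempty := ⟨_, single_mem_stdSimplex ℝ (Classical.arbitrary ι)⟩
  obtain ⟨w, hw, hmax⟩ := (isCompact_stdSimplex (𝕜 := ℝ) (ι := ι)).exists_isMaxOn hne hg.continuousOn
  -- By the variance identity, the variance of `y` is at most that of `K • (x - a)`, which is at
  -- most the mean of `r²`.
  have hgw : g w ≤ 0 := by
    have e1 := sum_sum_mul_norm_sub_sq w hw.2 y
    have e2 := sum_sum_mul_norm_sub_sq w hw.2 fun i => K • (x i - a)
    have e3 : ∑ i, ∑ j, w i * w j * ‖y i - y j‖ ^ 2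
        ≤ ∑ i, ∑ j, w i * w j * ‖K • (x i - a) - K • (x j - a)‖ ^ 2 := by
      refine Finset.sum_le_sum fun i _ => Finset.sum_le_sum fun j _ => ?_
      refine mul_le_mul_of_nonneg_left ?_ (mul_nonneg (hw.1 i) (hw.1 j))
      refine pow_le_pow_left₀ (norm_nonneg _) ?_ 2
      have := h i j
      rw [← smul_sub, norm_smul, Real.norm_of_nonneg hK, sub_sub_sub_cancel_right]
      simpa [dist_eq_norm] using this
    have e4 : ∑ i, w i * ‖K • (x i - a)‖ ^ 2 = ∑ i, w i * r i ^ 2 := by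
      refine Finset.sum_congr rfl fun i _ => ?_
      rw [norm_smul, Real.norm_of_nonneg hK, ← dist_eq_norm]
    have e5 : g w = ∑ i, w i * ‖y i‖ ^ 2 - ‖∑ i, w i • y i‖ ^ 2 - ∑ i, w i * r i ^ 2 := by
      simp only [g, α, mul_sub, Finset.sum_sub_distrib]; ring
    have e6 := sq_nonneg ‖∑ i, w i • (K • (x i - a))‖
    linarith
  let b := ∑ i, w i • y i
  refine ⟨b, fun i => ?_⟩
  -- Maximality of `w` along the segment to the vertex `i`; small `t` gives the first-order
  -- condition `hc`, which says `‖y i - b‖² - r i² ≤ g w`.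
  have hlin : ∀ t : ℝ, 0 ≤ t → t ≤ 1 →
      t * (α i - ∑ j, w j * α j - 2 * inner ℝ b (y i - b)) ≤ t ^ 2 * ‖y i - b‖ ^ 2 := by
    intro t h0 h1
    have hm : (1 - t) • w + t • Pi.single i 1 ∈ stdSimplex ℝ ι :=
      convex_stdSimplex ℝ ι hw (single_mem_stdSimplex ℝ i) (by linarith) h0 (by ring)
    have hle : g ((1 - t) • w + t • Pi.single i 1) ≤ g w := hmax hm
    have s1 : ∑ j, ((1 - t) • w + t • (Pi.single i 1 : ι → ℝ)) j * α j
        = (1 - t) * ∑ j, w j * α j + t * α i := by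
      simp only [Pi.add_apply, Pi.smul_apply, smul_eq_mul, add_mul, Finset.sum_add_distrib,
        mul_assoc, ← Finset.mul_sum]
      congr 2
      simp [Pi.single_apply]
    have s2 : ∑ j, ((1 - t) • w + t • (Pi.single i 1 : ι → ℝ)) j • y j
        = b + t • (y i - b) := by
      have : ∑ j, (Pi.single i 1 : ι → ℝ) j • y j = y i := by
        simp [Pi.single_apply]
      simp only [Pi.add_apply, Pi.smul_apply, smul_eq_mul, add_smul, Finset.sum_add_distrib,
        mul_smul, ← Finset.smul_sum, this]
      simp only [b]; module
    have s3 : ‖b + t • (y i - b)‖ ^ 2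
        = ‖b‖ ^ 2 + 2 * (t * inner ℝ b (y i - b)) + t ^ 2 * ‖y i - b‖ ^ 2 := by
      rw [norm_add_sq_real, real_inner_smul_right, norm_smul, mul_pow, Real.norm_eq_abs, sq_abs]
    simp only [g] at hle
    rw [s1, s2, s3] at hle
    change _ ≤ _ - ‖b‖ ^ 2 at hle
    linarith
  have hc : α i - ∑ j, w j * α j - 2 * inner ℝ b (y i - b) ≤ 0 := by
    by_contra! hpos
    set c := α i - ∑ j, w j * α j - 2 * inner ℝ b (y i - b) with hcdef
    have hN : 0 ≤ ‖y i - b‖ ^ 2 := by positivity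
    set N := ‖y i - b‖ ^ 2 with hNdef
    have ht : 0 < c / (c + N + 1) := by positivity
    have := hlin (c / (c + N + 1)) ht.le (by rw [div_le_one (by positivity)]; linarith)
    rw [pow_two, mul_assoc, mul_le_mul_iff_right₀ ht, div_mul_eq_mul_div, le_div_iff₀ (by positivity)] at this
    nlinarith
  have hr : 0 ≤ K * dist (x i) a := by positivity
  refine le_of_sq_le_sq ?_ hr
  have e : ‖y i‖ ^ 2 = ‖b‖ ^ 2 + 2 * inner ℝ b (y i - b) + ‖y i - b‖ ^ 2 := by
    rw [← norm_add_sq_real]; simp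
  have hb : g w = ∑ j, w j * α j - ‖b‖ ^ 2 := rfl
  have hα : α i = ‖y i‖ ^ 2 - (K * dist (x i) a) ^ 2 := rfl
  rw [dist_eq_norm]
  linarith

/-! ## Existence of centers, and costs of extensions -/

theorem dist_zext {d : ℕ} (p c : E d) (h : ℝ) :
    dist (zext p h) (zext c 0) = Real.sqrt (dist p c ^ 2 + h ^ 2) := by
  rw [WithLp.prod_dist_eq_of_L2]
  simp [zext]

theorem eq_zext_of_snd_eq_zero {d : ℕ} {c : EExt d} (hc : c.snd = 0) : c = zext c.fst 0 := by
  rw [← hc]; rfl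

/-- The cost is continuous, and for `z ≥ 1` a single summand already makes it coercive. -/
theorem exists_isCenterZero {d z : ℕ} (hz : 1 ≤ z) (X : Multiset (EExt d)) :
    ∃ c, IsCenterZero z X c := by
  rcases Multiset.empty_or_exists_mem X with rfl | ⟨x₀, hx₀⟩
  · exact ⟨zext 0 0, rfl, fun s' _ => by simp [cost]⟩
  have hcont : Continuous fun y : E d => cost z X (zext y 0) := by
    unfold cost zext
    refine continuous_multiset_sum _ fun x _ => ?_
    fun_prop
  have hle : ∀ y : E d, dist y x₀.fst ^ z ≤ cost z X (zext y 0) := by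
    intro y
    have h1 : dist x₀ (zext y 0) ^ z ≤ cost z X (zext y 0) :=
      Multiset.single_le_sum (by
        intro a ha
        obtain ⟨x, _, rfl⟩ := Multiset.mem_map.1 ha
        positivity) _ (Multiset.mem_map_of_mem _ hx₀)
    refine le_trans (pow_le_pow_left₀ dist_nonneg ?_ z) h1
    have hd : dist x₀ (zext y 0) = _ := dist_zext x₀.fst y x₀.snd
    rw [hd, dist_comm]
    exact Real.le_sqrt_of_sq_le (le_add_of_nonneg_right (sq_nonneg _))
  have htop : Filter.Tendsto (fun y : E d => dist y x₀.fst ^ z) (Filter.cocompact _) Filter.atTop :=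
    (Filter.tendsto_pow_atTop (by omega)).comp (tendsto_dist_right_cocompact_atTop x₀.fst)
  obtain ⟨y, hy⟩ := hcont.exists_forall_le (Filter.tendsto_atTop_mono hle htop)
  refine ⟨zext y 0, rfl, fun s' hs' => ?_⟩
  rw [eq_zext_of_snd_eq_zero hs']
  exact hy _

theorem sqrt_dist_add_le {a b h K : ℝ} (ha : 0 ≤ a) (hK : 1 ≤ K) (hab : a ≤ K * b) :
    Real.sqrt (a ^ 2 + h ^ 2) ≤ K * Real.sqrt (b ^ 2 + h ^ 2) := by
  rw [Real.sqrt_le_left (by positivity), mul_pow, Real.sq_sqrt (by positivity)]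
  have h1 : a ^ 2 ≤ (K * b) ^ 2 := pow_le_pow_left₀ ha hab 2
  nlinarith [mul_nonneg (sub_nonneg.2 (one_le_pow₀ hK (n := 2))) (sq_nonneg h)]

/-- Pointwise domination of distances by a factor `K ≥ 1` gives domination of costs by `K ^ z`. -/
theorem cost_mapExt_le {d m z : ℕ} {X : Multiset (EExt d)} {Φ : E d →ₗ[ℝ] E m} {K : ℝ} (hK : 1 ≤ K)
    (c : E d) (s : E m) (h : ∀ x ∈ X, dist (Φ x.fst) s ≤ K * dist x.fst c) :
    cost z (mapExt Φ X) (zext s 0) ≤ K ^ z * cost z X (zext c 0) := by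
  unfold cost mapExt
  rw [Multiset.map_map, ← Multiset.sum_map_mul_left]
  refine Multiset.sum_map_le_sum_map _ _ fun x hx => ?_
  have hx' : x = zext x.fst x.snd := rfl
  rw [Function.comp_apply, ← mul_pow, dist_zext]
  conv_rhs => rw [hx', dist_zext]
  exact pow_le_pow_left₀ (Real.sqrt_nonneg _) (sqrt_dist_add_le dist_nonneg hK (h x hx)) z

theorem cost_le_mapExt {d m z : ℕ} {X : Multiset (EExt d)} {Φ : E d →ₗ[ℝ] E m} {K : ℝ} (hK : 1 ≤ K)
    (c : E d) (s : E m) (h : ∀ x ∈ X, dist x.fst c ≤ K * dist (Φ x.fst) s) :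
    cost z X (zext c 0) ≤ K ^ z * cost z (mapExt Φ X) (zext s 0) := by
  unfold cost mapExt
  rw [Multiset.map_map, ← Multiset.sum_map_mul_left]
  refine Multiset.sum_map_le_sum_map _ _ fun x hx => ?_
  have hx' : x = zext x.fst x.snd := rfl
  rw [Function.comp_apply, ← mul_pow, dist_zext]
  conv_lhs => rw [hx', dist_zext]
  exact pow_le_pow_left₀ (Real.sqrt_nonneg _) (sqrt_dist_add_le dist_nonneg hK (h x hx)) z

theorem cost_nonneg {d z : ℕ} (X : Multiset (EExt d)) (s : EExt d) : 0 ≤ cost z X s := by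
  refine Multiset.sum_nonneg fun a ha => ?_
  obtain ⟨x, _, rfl⟩ := Multiset.mem_map.1 ha
  positivity

/-- A net that contains the points and a `(1 + ε / (16 z))`-substitute for every point of the
space suffices for preserving the costs. -/
theorem cost_preserved {d m z : ℕ} {ε : ℝ} (hz : 1 ≤ z) (h0 : 0 < ε) (h1 : ε < 1)
    {L : List (E d)} {N : Set (E d)} (hLN : ∀ p ∈ L, p ∈ N)
    (hN : ∀ c : E d, ∃ s ∈ N, ∀ p ∈ L, dist p s ≤ (1 + ε / (16 * z)) * dist p c)
    {Φ : E d →ₗ[ℝ] E m} (hΦ : PreservesDist Φ N (ε / z))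
    {X : Multiset (EExt d)} (hX : ∀ x ∈ X, x.fst ∈ L) {c : EExt d} {cΦ : EExt m}
    (hc : IsCenterZero z X c) (hcΦ : IsCenterZero z (mapExt Φ X) cΦ) :
    (1 - 2 * ε) * cost z X c ≤ cost z (mapExt Φ X) cΦ ∧
      cost z (mapExt Φ X) cΦ ≤ (1 + 2 * ε) * cost z X c := by
  have hz' : (1 : ℝ) ≤ z := by exact_mod_cast hz
  have hδ0 : 0 < ε / z := by positivity
  have hδ1 : ε / z < 1 := by rw [div_lt_one (by positivity)]; linarith
  have hzδ : (z : ℝ) * (ε / z) = ε := by field_simp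
  constructor
  · have hpos : 0 < 1 - ε / z := by linarith
    obtain ⟨b, hb⟩ := exists_dist_le_of_forall_dist_le (1 - ε / z)⁻¹ (by positivity)
      (fun i : Fin L.length => Φ (L.get i)) (fun i => L.get i) (fun i j => by
        rw [← div_eq_inv_mul, le_div_iff₀ hpos, mul_comm]
        exact (hΦ _ (hLN _ (L.get_mem i)) _ (hLN _ (L.get_mem j))).1) cΦ.fst
    have h2 : cost z X (zext b 0)
        ≤ (1 - ε / z)⁻¹ ^ z * cost z (mapExt Φ X) (zext cΦ.fst 0) := by
      refine cost_le_mapExt ((one_le_inv₀ hpos).2 (by linarith)) _ _ fun x hx => ?_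
      obtain ⟨i, hi⟩ := List.get_of_mem (hX x hx)
      have := hb i
      rwa [hi] at this
    rw [← eq_zext_of_snd_eq_zero hcΦ.1, inv_pow, ← div_eq_inv_mul,
      le_div_iff₀ (pow_pos hpos z)] at h2
    have h3 := hc.2 (zext b 0) rfl
    -- Bernoulli's inequality gives even `1 - ε`.
    have h4 : 1 - 2 * ε ≤ (1 - ε / z) ^ z := by
      have := one_add_mul_le_pow (a := -(ε / z)) (by linarith) z
      rw [mul_neg, hzδ] at this
      rw [sub_eq_add_neg 1 (ε / z)]
      linarith
    calc (1 - 2 * ε) * cost z X c ≤ (1 - ε / z) ^ z * cost z X c :=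
          mul_le_mul_of_nonneg_right h4 (cost_nonneg _ _)
      _ ≤ (1 - ε / z) ^ z * cost z X (zext b 0) :=
          mul_le_mul_of_nonneg_left h3 (pow_pos hpos z).le
      _ ≤ _ := by rw [mul_comm]; exact h2
  · obtain ⟨s, hs, hsd⟩ := hN c.fst
    have hK : 1 ≤ (1 + ε / z) * (1 + ε / (16 * z)) := by
      have : 0 ≤ ε / (16 * z) := by positivity
      nlinarith
    have h2 : cost z (mapExt Φ X) (zext (Φ s) 0)
        ≤ ((1 + ε / z) * (1 + ε / (16 * z))) ^ z * cost z X (zext c.fst 0) := by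
      refine cost_mapExt_le hK _ _ fun x hx => ?_
      refine (hΦ _ (hLN _ (hX x hx)) _ hs).2.trans ?_
      rw [mul_assoc]
      exact mul_le_mul_of_nonneg_left (hsd _ (hX x hx)) (by positivity)
    rw [← eq_zext_of_snd_eq_zero hc.1] at h2
    have h3 := hcΦ.2 (zext (Φ s) 0) rfl
    refine (h3.trans h2).trans (mul_le_mul_of_nonneg_right ?_ (cost_nonneg _ _))
    -- The net loss `ε / (16 z)` is small enough for `exp (17 / 16) ≤ 3`; then `3 ^ ε ≤ 1 + 2 ε` by
    -- Bernoulli's inequality with exponent at most `1`.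
    have e1 : ((1 + ε / z) * (1 + ε / (16 * z))) ^ z ≤ Real.exp (17 / 16 * ε) := by
      have e2 : (1 + ε / z) * (1 + ε / (16 * z)) ≤ Real.exp (ε / z) * Real.exp (ε / (16 * z)) := by
        gcongr
        · linarith [Real.add_one_le_exp (ε / z)]
        · linarith [Real.add_one_le_exp (ε / (16 * z))]
      refine (pow_le_pow_left₀ (by positivity) e2 z).trans_eq ?_
      rw [← Real.exp_add, ← Real.exp_nat_mul]
      congr 1
      field_simp; norm_num
    have e3 : Real.exp (17 / 16) ≤ 3 := by
      have a1 : Real.exp (17 / 16) * (1 - 1 / 16) ≤ Real.exp 1 := by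
        have := Real.add_one_le_exp (-(1 / 16 : ℝ))
        calc Real.exp (17 / 16) * (1 - 1 / 16) ≤ Real.exp (17 / 16) * Real.exp (-(1 / 16)) := by
              gcongr; linarith
          _ = Real.exp 1 := by rw [← Real.exp_add]; norm_num
      linarith [Real.exp_one_lt_d9]
    refine e1.trans ?_
    rw [Real.exp_mul]
    calc Real.exp (17 / 16) ^ ε ≤ (1 + 2) ^ ε :=
          Real.rpow_le_rpow (by positivity) (by linarith) h0.le
      _ ≤ 1 + ε * 2 := rpow_one_add_le_one_add_mul_self (by norm_num) h0.le h1.le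
      _ = _ := by ring

end Clustering

namespace Clustering

/-! ## A net generated by normalized steps towards the points -/

/-- `Reach L x₀ e₀ t y e`: the point `y` with step size `e` arises from `x₀` with step size `e₀` by
`t` operations: jump to a point of `L` and let the step size be the length of the jump, halve the
step size, or make a step towards a point of `L`. -/
inductive Reach {d : ℕ} (L : List (E d)) (x₀ : E d) (e₀ : ℝ) : ℕ → E d → ℝ → Prop where
  | root : Reach L x₀ e₀ 0 x₀ e₀
  | jump {t : ℕ} {y : E d} {e : ℝ} {p : E d} (hp : p ∈ L) :
      Reach L x₀ e₀ t y e → Reach L x₀ e₀ (t + 1) p (dist p y)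
  | half {t : ℕ} {y : E d} {e : ℝ} {p : E d} (hp : p ∈ L) :
      Reach L x₀ e₀ t y e → Reach L x₀ e₀ (t + 1) y (e / 2)
  | step {t : ℕ} {y : E d} {e : ℝ} {p : E d} (hp : p ∈ L) :
      Reach L x₀ e₀ t y e → Reach L x₀ e₀ (t + 1) (y + (e / dist p y) • (p - y)) e

/-- A step of length `η` towards a point `p` that is farther from `s` than from `c` by more than
`η` brings `s` closer to `c`. -/
theorem dist_sq_step_le {F : Type*} [NormedAddCommGroup F] [InnerProductSpace ℝ F] {s c p : F}
    {η : ℝ} (hη : 0 < η) (h : dist p c + η < dist p s) :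
    dist (s + (η / dist p s) • (p - s)) c ^ 2 ≤ dist s c ^ 2 - η ^ 2 := by
  have ha : 0 < dist p s := by linarith [dist_nonneg (x := p) (y := c)]
  have htri := dist_triangle p c s
  rw [dist_comm c s] at htri
  have e1 : dist (s + (η / dist p s) • (p - s)) c ^ 2
      = dist s c ^ 2 + 2 * (η / dist p s) * inner ℝ (s - c) (p - s) + η ^ 2 := by
    rw [dist_eq_norm, show s + (η / dist p s) • (p - s) - c
      = (s - c) + (η / dist p s) • (p - s) by abel, norm_add_sq_real, real_inner_smul_right,
      norm_smul, ← dist_eq_norm, ← dist_eq_norm, Real.norm_of_nonneg (by positivity),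
      div_mul_cancel₀ _ ha.ne']
    ring
  have e2 : dist p c ^ 2 = dist s c ^ 2 + 2 * inner ℝ (s - c) (p - s) + dist p s ^ 2 := by
    rw [dist_eq_norm, dist_eq_norm, dist_eq_norm, ← norm_add_sq_real]
    congr 2; abel
  have e3 : 2 * (η / dist p s) * inner ℝ (s - c) (p - s)
      = η * (dist p c ^ 2 - dist s c ^ 2 - dist p s ^ 2) / dist p s := by
    rw [e2]; field_simp; ring
  rw [e1, e3]
  have hb := dist_nonneg (x := p) (y := c)
  -- Uses `η ≤ dist s c`, from the triangle inequality, and `dist p c ≤ dist p s - η`.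
  have : η * (dist p c ^ 2 - dist s c ^ 2 - dist p s ^ 2) / dist p s ≤ -(2 * η ^ 2) := by
    rw [div_le_iff₀ ha]
    have h1 : η ^ 2 ≤ dist s c ^ 2 := pow_le_pow_left₀ hη.le (by linarith) 2
    have h2 : dist p c ^ 2 ≤ (dist p s - η) ^ 2 := pow_le_pow_left₀ hb (by linarith) 2
    nlinarith
  linarith

/-- Finitely many steps of length `η` lead to a point whose distance to every point of `L` exceeds
that of `c` by at most `η`. -/
theorem exists_reach_of_dist_sq_le {d : ℕ} {L : List (E d)} {x₀ : E d} {e₀ η B : ℝ} {c : E d}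
    (hη : 0 < η) (k : ℕ) :
    ∀ (t : ℕ) (s : E d), Reach L x₀ e₀ t s η → dist s c ^ 2 ≤ B → B < (k + 1) * η ^ 2 →
      ∃ t' ≤ t + k, ∃ s', Reach L x₀ e₀ t' s' η ∧ ∀ p ∈ L, dist p s' ≤ dist p c + η := by
  induction k generalizing B with
  | zero =>
    intro t s hs hB hk
    refine ⟨t, le_rfl, s, hs, fun p hp => ?_⟩
    -- Since `B < η ^ 2`, one more step would make a squared distance negative.
    by_contra! h
    have h1 := dist_sq_step_le hη h
    have h2 := sq_nonneg (dist (s + (η / dist p s) • (p - s)) c)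
    simp only [Nat.cast_zero, zero_add, one_mul] at hk
    linarith
  | succ k ih =>
    intro t s hs hB hk
    by_cases hgood : ∀ p ∈ L, dist p s ≤ dist p c + η
    · exact ⟨t, by omega, s, hs, hgood⟩
    push Not at hgood
    obtain ⟨p, hp, h⟩ := hgood
    have h1 := dist_sq_step_le hη h
    obtain ⟨t', ht', s', h'⟩ := ih (B := B - η ^ 2) (t + 1) _ (hs.step hp) (by linarith)
      (by push_cast at hk; linarith)
    exact ⟨t', by omega, s', h'⟩

/-- Take the least `j` with `D / 2 ^ j ≤ r`. By minimality `2 ^ (j - 1) < 1 / β`. The linear bound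
on `j` is crude, but of the same order `δ⁻²` as the number of steps that follow. -/
theorem exists_half_pow {D r β : ℝ} (hβ : 0 < β) (hr0 : 0 < r) (hrD : r < D) (hr : D * β < r) :
    ∃ j : ℕ, (j : ℝ) ≤ 1 + 1 / β ∧ D / 2 ^ j ≤ r ∧ r / 2 < D / 2 ^ j := by
  have hD : 0 < D := hr0.trans hrD
  have hex : ∃ j : ℕ, D / 2 ^ j ≤ r := by
    obtain ⟨j, hj⟩ := pow_unbounded_of_one_lt (D / r) (by norm_num : (1 : ℝ) < 2)
    refine ⟨j, ?_⟩
    rw [div_lt_iff₀ hr0] at hj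
    rw [div_le_iff₀ (by positivity)]
    linarith
  classical
  have hspec := Nat.find_spec hex
  have hmin := fun i => Nat.find_min hex (m := i)
  obtain hj | ⟨i, hi⟩ : Nat.find hex = 0 ∨ ∃ i, Nat.find hex = i + 1 := by
    cases h : Nat.find hex <;> simp
  · rw [hj] at hspec; simp at hspec; linarith
  have h1 := hmin i (by omega)
  push Not at h1
  refine ⟨i + 1, ?_, hi ▸ hspec, ?_⟩
  · have h2 : (i : ℝ) < 2 ^ i := by exact_mod_cast Nat.lt_two_pow_self
    have h3 : (2 : ℝ) ^ i * β ≤ 1 := by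
      rw [lt_div_iff₀ (by positivity)] at h1
      have : D * (2 ^ i * β) < D * 1 := by
        calc D * (2 ^ i * β) = 2 ^ i * (D * β) := by ring
          _ < 2 ^ i * r := by gcongr
          _ < D * 1 := by linarith
      exact (lt_of_mul_lt_mul_left this hD.le).le
    have h4 : (2 : ℝ) ^ i ≤ 1 / β := by rwa [le_div_iff₀ hβ]
    push_cast; linarith
  · rw [pow_succ, ← div_div]; linarith

theorem Reach.half_iterate {d : ℕ} {L : List (E d)} {x₀ : E d} {e₀ : ℝ} {p : E d} (hp : p ∈ L)
    {t : ℕ} {y : E d} {e : ℝ} (h : Reach L x₀ e₀ t y e) (j : ℕ) :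
    Reach L x₀ e₀ (t + j) y (e / 2 ^ j) := by
  induction j with
  | zero => simpa using h
  | succ j ih =>
    have := ih.half hp
    rwa [div_div, ← pow_succ] at this

/-- For every point `c` of the space, few operations lead to a point that is, up to a factor
`1 + δ`, at least as close to all points of `L` as `c`. -/
theorem exists_reach_dist_le {d : ℕ} {L : List (E d)} {x₀ : E d} {e₀ δ : ℝ} (hδ : 0 < δ)
    (hδ1 : δ < 1) {K : ℕ} (hK : 9 / δ ^ 2 ≤ K) (c : E d) :
    ∃ t ≤ K, ∃ s e, Reach L x₀ e₀ t s e ∧ ∀ p ∈ L, dist p s ≤ (1 + δ) * dist p c := by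
  rcases L.eq_nil_or_concat with hL | hL
  · exact ⟨0, by omega, x₀, e₀, .root, by simp [hL]⟩
  have hne : L.toFinset.Nonempty := by
    obtain ⟨l, b, rfl⟩ := hL
    exact ⟨b, by simp⟩
  obtain ⟨s₀, hs₀, hmin⟩ := L.toFinset.exists_min_image (fun p => dist p c) hne
  simp only [List.mem_toFinset] at hs₀ hmin
  have hδ2 : 0 < δ ^ 2 := by positivity
  have hδ2' : δ ^ 2 < 1 := pow_lt_one₀ hδ.le hδ1 (by norm_num)
  have hinv : 1 < 1 / δ ^ 2 := by rwa [lt_div_iff₀ hδ2, one_mul]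
  have hK' : 9 * (1 / δ ^ 2) ≤ K := by rwa [mul_one_div]
  by_cases hgood : ∀ p ∈ L, dist p s₀ ≤ (1 + δ) * dist p c
  · refine ⟨1, ?_, s₀, _, Reach.root.jump hs₀, hgood⟩
    have : (1 : ℝ) ≤ K := by linarith
    exact_mod_cast this
  push Not at hgood
  obtain ⟨q, hq, hqD⟩ := hgood
  set R := dist s₀ c with hR
  set D := dist s₀ q with hD
  rw [dist_comm q s₀, ← hD] at hqD
  have hRq : R ≤ dist q c := hmin q hq
  have hR0 : 0 ≤ R := dist_nonneg
  have htri : D ≤ R + dist q c := by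
    rw [hR, hD, dist_comm q c]; exact dist_triangle _ _ _
  have hRD : R < D := by nlinarith
  have hDR : D * (δ / 2) < R := by nlinarith
  have hRpos : 0 < R := by nlinarith
  -- `D` and `R` are comparable: `R < D` because `R ≤ dist q c`, and `D * (δ / 2) < R` because `q`
  -- is bad for `s₀`. The operations number `2` jumps, `j ≤ 1 + 2 / δ ^ 2` halvings and at most `4 /
  -- δ ^ 2` steps, in total at most `9 / δ ^ 2`.
  obtain ⟨j, hj, hj1, hj2⟩ := exists_half_pow (D := D) (r := δ * R) (β := δ ^ 2 / 2) (by positivity)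
    (by positivity) (by nlinarith) (by nlinarith)
  set η := D / 2 ^ j with hη
  have hη0 : 0 < η := lt_trans (by positivity) hj2
  have hreach : Reach L x₀ e₀ (1 + 1 + j) s₀ η :=
    (((Reach.root.jump hq).jump hs₀).half_iterate hs₀ j)
  have hk : R ^ 2 < ((⌊4 / δ ^ 2⌋₊ : ℕ) + 1) * η ^ 2 := by
    have h1 := Nat.lt_floor_add_one (4 / δ ^ 2)
    have h2 : (δ * R / 2) ^ 2 ≤ η ^ 2 := pow_le_pow_left₀ (by positivity) hj2.le 2
    calc R ^ 2 = 4 / δ ^ 2 * (δ * R / 2) ^ 2 := by field_simp; ring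
      _ ≤ 4 / δ ^ 2 * η ^ 2 := by gcongr
      _ < _ := by gcongr
  obtain ⟨t', ht', s', hs', hd⟩ := exists_reach_of_dist_sq_le hη0 _ _ _ hreach le_rfl hk
  refine ⟨t', ?_, s', η, hs', fun p hp => (hd p hp).trans ?_⟩
  · refine ht'.trans ?_
    have h1 : ((⌊4 / δ ^ 2⌋₊ : ℕ) : ℝ) ≤ 4 / δ ^ 2 := Nat.floor_le (by positivity)
    have h2 : (4 : ℝ) / δ ^ 2 = 4 * (1 / δ ^ 2) := by ring
    have h3 : 1 / (δ ^ 2 / 2) = 2 * (1 / δ ^ 2) := by field_simp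
    have : ((1 + 1 + j + ⌊4 / δ ^ 2⌋₊ : ℕ) : ℝ) ≤ K := by
      push_cast
      linarith
    exact_mod_cast this
  -- The additive error `η ≤ δ * R` is a relative one, since `R ≤ dist p c` for every `p ∈ L`.
  · have := hmin p hp
    nlinarith

/-- `x` and `η` list the points and step sizes that arise from the nodes `i < M`, the children of
node `i` being the nodes `3 * (i * L.length + p) + 1, …, 3 * (i * L.length + p) + 3`. -/
def IsTree {d : ℕ} (L : List (E d)) (M : ℕ) (x : ℕ → E d) (η : ℕ → ℝ) : Prop :=
  ∀ i < M, ∀ (p : ℕ) (hp : p < L.length),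
    x (3 * (i * L.length + p) + 1) = L.get ⟨p, hp⟩ ∧
    η (3 * (i * L.length + p) + 1) = dist (L.get ⟨p, hp⟩) (x i) ∧
    x (3 * (i * L.length + p) + 2) = x i ∧
    η (3 * (i * L.length + p) + 2) = η i / 2 ∧
    x (3 * (i * L.length + p) + 3)
      = x i + (η i / dist (L.get ⟨p, hp⟩) (x i)) • (L.get ⟨p, hp⟩ - x i) ∧
    η (3 * (i * L.length + p) + 3) = η i

/-- Nodes of depth `t` have numbers below `(3 * L.length + 1) ^ t`, so expanding the first `(3 *
L.length + 1) ^ K` nodes covers all `K` levels. Halving carries an irrelevant point too, so that all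
three operations are indexed alike. -/
theorem IsTree.exists_index {d K : ℕ} {L : List (E d)} {x : ℕ → E d} {η : ℕ → ℝ}
    (h : IsTree L ((3 * L.length + 1) ^ K) x η) {t : ℕ} {y : E d} {e : ℝ}
    (hr : Reach L (x 0) (η 0) t y e) (ht : t ≤ K) :
    ∃ i < (3 * L.length + 1) ^ t, x i = y ∧ η i = e := by
  have hchild : ∀ {i p t o : ℕ}, i < (3 * L.length + 1) ^ t → p < L.length → o ≤ 3 →
      3 * (i * L.length + p) + o < (3 * L.length + 1) ^ (t + 1) := by
    intro i p t o hi hp ho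
    rw [pow_succ]
    calc 3 * (i * L.length + p) + o < (i + 1) * (3 * L.length + 1) := by nlinarith
      _ ≤ _ := Nat.mul_le_mul_right _ hi
  have hM : ∀ {i t : ℕ}, i < (3 * L.length + 1) ^ t → t ≤ K → i < (3 * L.length + 1) ^ K :=
    fun hi ht => hi.trans_le (Nat.pow_le_pow_right (by omega) ht)
  induction hr with
  | root => exact ⟨0, by simp, rfl, rfl⟩
  | jump hp _ ih =>
    obtain ⟨i, hi, rfl, rfl⟩ := ih (by omega)
    obtain ⟨⟨p, hpL⟩, rfl⟩ := List.get_of_mem hp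
    have := h i (hM hi (by omega)) p hpL
    exact ⟨_, hchild hi hpL (by omega), this.1, this.2.1⟩
  | half hp _ ih =>
    obtain ⟨i, hi, rfl, rfl⟩ := ih (by omega)
    obtain ⟨⟨p, hpL⟩, rfl⟩ := List.get_of_mem hp
    have := h i (hM hi (by omega)) p hpL
    exact ⟨_, hchild hi hpL (by omega), this.2.2.1, this.2.2.2.1⟩
  | step hp _ ih =>
    obtain ⟨i, hi, rfl, rfl⟩ := ih (by omega)
    obtain ⟨⟨p, hpL⟩, rfl⟩ := List.get_of_mem hp
    have := h i (hM hi (by omega)) p hpL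
    exact ⟨_, hchild hi hpL (by omega), this.2.2.2.2.1, this.2.2.2.2.2⟩

end Clustering

namespace RealRAM

/-! ## Rules for running programs -/

/-- `p`, started in `s`, halts within `B` steps in a memory that satisfies `Q`. -/
def Runs (p : Prog) (s : Mem) (B : ℕ) (Q : Mem → Prop) : Prop :=
  ∃ t s', Exec p s t s' ∧ t ≤ B ∧ Q s'

theorem Runs.mono {p : Prog} {s : Mem} {B B' : ℕ} {Q Q' : Mem → Prop} (h : Runs p s B Q)
    (hB : B ≤ B') (hQ : ∀ s', Q s' → Q' s') : Runs p s B' Q' := by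
  obtain ⟨t, s', h1, h2, h3⟩ := h
  exact ⟨t, s', h1, h2.trans hB, hQ _ h3⟩

theorem Runs.seq {p q : Prog} {s : Mem} {B₁ B₂ : ℕ} {Q₁ Q : Mem → Prop} (h : Runs p s B₁ Q₁)
    (h' : ∀ s', Q₁ s' → Runs q s' B₂ Q) : Runs (.seq p q) s (B₁ + B₂) Q := by
  obtain ⟨t, s', h1, h2, h3⟩ := h
  obtain ⟨t', s'', h1', h2', h3'⟩ := h' s' h3
  exact ⟨_, _, .seq h1 h1', by omega, h3'⟩

theorem runs_setNat {a : ℕ} {i e : NExp} {s : Mem} {Q : Mem → Prop}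
    (h : Q (s.writeNat a (i.eval s) (e.eval s))) :
    Runs (.setNat a i e) s (i.time + e.time + 1) Q :=
  ⟨_, _, .setNat s a i e, le_rfl, h⟩

theorem runs_setReal {a : ℕ} {i : NExp} {e : RExp} {s : Mem} {Q : Mem → Prop}
    (h : Q (s.writeReal a (i.eval s) (e.eval s))) :
    Runs (.setReal a i e) s (i.time + e.time + 1) Q :=
  ⟨_, _, .setReal s a i e, le_rfl, h⟩

theorem runs_setNat_seq {a : ℕ} {i e : NExp} {q : Prog} {s : Mem} {B : ℕ} {Q : Mem → Prop}
    (h : Runs q (s.writeNat a (i.eval s) (e.eval s)) B Q) :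
    Runs (.seq (.setNat a i e) q) s (i.time + e.time + 1 + B) Q :=
  (runs_setNat (Q := fun s' => s' = s.writeNat a (i.eval s) (e.eval s)) rfl).seq
    fun _ hs => hs ▸ h

theorem runs_setReal_seq {a : ℕ} {i : NExp} {e : RExp} {q : Prog} {s : Mem} {B : ℕ}
    {Q : Mem → Prop} (h : Runs q (s.writeReal a (i.eval s) (e.eval s)) B Q) :
    Runs (.seq (.setReal a i e) q) s (i.time + e.time + 1 + B) Q :=
  (runs_setReal (Q := fun s' => s' = s.writeReal a (i.eval s) (e.eval s)) rfl).seq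
    fun _ hs => hs ▸ h

/-- A loop whose test succeeds exactly `N` times. -/
theorem runs_loop {b : Test} {p : Prog} {B : ℕ} (N : ℕ) (Inv : ℕ → Mem → Prop)
    (hT : ∀ k < N, ∀ s, Inv k s → b.holds s) (hF : ∀ s, Inv N s → ¬ b.holds s)
    (hstep : ∀ k < N, ∀ s, Inv k s → Runs p s B (Inv (k + 1))) {s : Mem} (h0 : Inv 0 s) :
    Runs (.loop b p) s (N * (b.time + B) + b.time) (Inv N) := by
  have key : ∀ m k s, k + m = N → Inv k s →
      Runs (.loop b p) s (m * (b.time + B) + b.time) (Inv N) := by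
    intro m
    induction m with
    | zero =>
      intro k s hk hs
      obtain rfl : k = N := by omega
      exact ⟨_, _, .loopFalse (hF s hs), by simp, hs⟩
    | succ m ih =>
      intro k s hk hs
      obtain ⟨t, s', h1, h2, h3⟩ := hstep k (by omega) s hs
      obtain ⟨t', s'', h1', h2', h3'⟩ := ih (k + 1) s' (by omega) h3
      refine ⟨_, _, .loopTrue (hT k (by omega) s hs) h1 h1', ?_, h3'⟩
      rw [Nat.add_mul, one_mul]; omega
  exact key N 0 s (by omega) h0

/-- The natural variable kept in cell `0` of array `a`. -/
abbrev NExp.var (a : ℕ) : NExp := .load a (.const 0)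

/-- `for v < e do p`. -/
def forLoop (v : ℕ) (e : NExp) (p : Prog) : Prog :=
  .seq (.setNat v (.const 0) (.const 0))
    (.loop (.natLt (.var v) e) (.seq p (.setNat v (.const 0) (.add (.var v) (.const 1)))))

/-- `Inv k` describes the memory before the `k`-th test; it must fix the counter and the value of
the bound `e`, which is evaluated anew at each test. -/
theorem runs_forLoop {v : ℕ} {e : NExp} {p : Prog} {B : ℕ} (N : ℕ) (Inv : ℕ → Mem → Prop)
    (hv : ∀ k s, Inv k s → s.nat v 0 = k) (he : ∀ k s, Inv k s → e.eval s = N)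
    (hstep : ∀ k < N, ∀ s, Inv k s →
      Runs p s B fun s' => s'.nat v 0 = k ∧ Inv (k + 1) (s'.writeNat v 0 (k + 1)))
    {s : Mem} (h0 : Inv 0 (s.writeNat v 0 0)) :
    Runs (forLoop v e p) s (N * (B + e.time + 9) + e.time + 6) (Inv N) := by
  have hloop := runs_loop (b := .natLt (.var v) e)
    (p := .seq p (.setNat v (.const 0) (.add (.var v) (.const 1)))) (B := B + 6) N Inv
    (fun k hk s hs => by
      simp only [Test.holds, NExp.eval, hv k s hs, he k s hs]; exact hk)
    (fun s hs => by
      simp only [Test.holds, NExp.eval, hv _ s hs, he _ s hs]; exact lt_irrefl _)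
    (fun k hk s hs => by
      refine (hstep k hk s hs).seq fun s' hs' => ?_
      refine runs_setNat ?_
      simp only [NExp.eval, hs'.1]; exact hs'.2) h0
  refine (runs_setNat_seq hloop).mono ?_ fun _ h => h
  simp only [NExp.time, Test.time]
  rw [show 1 + 1 + e.time + 1 + (B + 6) = B + e.time + 9 by ring]
  omega

/-! ### Reading a memory after a write -/

namespace Mem

@[simp] theorem writeNat_real (s : Mem) (a i v : ℕ) : (s.writeNat a i v).real = s.real := rfl

@[simp] theorem writeReal_nat (s : Mem) (a i : ℕ) (v : ℝ) : (s.writeReal a i v).nat = s.nat := rfl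

@[simp] theorem writeNat_nat_self (s : Mem) (a i v : ℕ) : (s.writeNat a i v).nat a i = v := by
  simp [writeNat]

@[simp] theorem writeReal_real_self (s : Mem) (a i : ℕ) (v : ℝ) :
    (s.writeReal a i v).real a i = v := by
  simp [writeReal]

theorem writeNat_nat_of_ne (s : Mem) {a a' : ℕ} (i v : ℕ) (h : a' ≠ a) :
    (s.writeNat a i v).nat a' = s.nat a' := by
  simp [writeNat, h]

theorem writeReal_real_of_ne (s : Mem) {a a' : ℕ} (i : ℕ) (v : ℝ) (h : a' ≠ a) :
    (s.writeReal a i v).real a' = s.real a' := by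
  simp [writeReal, h]

theorem writeReal_real_of_ne_cell (s : Mem) (a : ℕ) {i i' : ℕ} (v : ℝ) (h : i' ≠ i) :
    (s.writeReal a i v).real a i' = s.real a i' := by
  simp [writeReal, h]

end Mem

end RealRAM

namespace Clustering

open RealRAM

/-! ## The program that computes the net

Natural arrays: `1` number of nodes to expand, `2` depth, `3`, `4`, `5` loop counters. Real arrays:
`2` points of the nodes, `3` step sizes of the nodes, `4` a distance. -/

/-- Cell of coordinate `j` of point number `e`. -/
def coord (e : NExp) : NExp := .add (.mul e (.load 0 (.const 0))) (.var 5)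

/-- Number of the first child of node `i` for point `p`, plus `o`. -/
def childNode (o : ℕ) : NExp :=
  .add (.mul (.const 3) (.add (.mul (.var 3) (.load 0 (.const 1))) (.var 4))) (.const (o + 1))

def accProg : Prog :=
  .setReal 4 (.const 0) (.add (.load 4 (.const 0))
    (.mul (.sub (.load 1 (coord (.var 4))) (.load 2 (coord (.var 3))))
      (.sub (.load 1 (coord (.var 4))) (.load 2 (coord (.var 3))))))

def writeProg : Prog :=
  .seq (.setReal 2 (coord (childNode 0)) (.load 1 (coord (.var 4))))
  (.seq (.setReal 2 (coord (childNode 1)) (.load 2 (coord (.var 3))))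
  (.setReal 2 (coord (childNode 2)) (.add (.load 2 (coord (.var 3)))
    (.mul (.div (.load 3 (.var 3)) (.load 4 (.const 0)))
      (.sub (.load 1 (coord (.var 4))) (.load 2 (coord (.var 3))))))))

def childrenProg : Prog :=
  .seq (.setReal 4 (.const 0) (.ofNat (.const 0)))
  (.seq (forLoop 5 (.load 0 (.const 0)) accProg)
  (.seq (.setReal 4 (.const 0) (.sqrt (.load 4 (.const 0))))
  (.seq (.setReal 3 (childNode 0) (.load 4 (.const 0)))
  (.seq (.setReal 3 (childNode 1) (.div (.load 3 (.var 3)) (.ofNat (.const 2))))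
  (.seq (.setReal 3 (childNode 2) (.load 3 (.var 3)))
  (forLoop 5 (.load 0 (.const 0)) writeProg))))))

def expandProg : Prog :=
  forLoop 3 (.var 1) (forLoop 4 (.load 0 (.const 1)) childrenProg)

/-- The machine has no rounding of reals to naturals. The ceiling of `2304 z² / ε²` is found by
counting up while `k ε² < 2304 z²`, and the power is accumulated along the way. -/
def depthProg : Prog :=
  .seq (.setNat 1 (.const 0) (.const 1))
  (.loop (.realLt (.mul (.ofNat (.var 2)) (.mul (.load 0 (.const 0)) (.load 0 (.const 0))))
      (.mul (.ofNat (.const 2304)) (.mul (.ofNat (.load 0 (.const 2))) (.ofNat (.load 0 (.const 2))))))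
    (.seq (.setNat 2 (.const 0) (.add (.var 2) (.const 1)))
      (.setNat 1 (.const 0)
        (.mul (.var 1) (.add (.mul (.const 3) (.load 0 (.const 1))) (.const 1))))))

def netProg : Prog := .seq depthProg expandProg

/-- The squared distance between point `p` and node `i`, up to coordinate `k`. -/
def sqDist (s : Mem) (d p i k : ℕ) : ℝ :=
  ∑ j ∈ Finset.range k, (s.real 1 (p * d + j) - s.real 2 (i * d + j)) ^ 2

/-- The cells of the children of node `i` for point `p` hold their points and step sizes. -/
def HasChildren (d n : ℕ) (s : Mem) (i p : ℕ) : Prop :=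
  s.real 3 (3 * (i * n + p) + 1) = Real.sqrt (sqDist s d p i d) ∧
  s.real 3 (3 * (i * n + p) + 2) = s.real 3 i / 2 ∧
  s.real 3 (3 * (i * n + p) + 3) = s.real 3 i ∧
  ∀ j < d,
    s.real 2 ((3 * (i * n + p) + 1) * d + j) = s.real 1 (p * d + j) ∧
    s.real 2 ((3 * (i * n + p) + 2) * d + j) = s.real 2 (i * d + j) ∧
    s.real 2 ((3 * (i * n + p) + 3) * d + j) = s.real 2 (i * d + j)
      + s.real 3 i / Real.sqrt (sqDist s d p i d) * (s.real 1 (p * d + j) - s.real 2 (i * d + j))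

/-! ### Correctness and running time of the program -/

theorem cell_lt {d j a b : ℕ} (hj : j < d) (hab : a < b) : a * d + j < b * d := by
  calc a * d + j < a * d + d := by omega
    _ = (a + 1) * d := by ring
    _ ≤ b * d := Nat.mul_le_mul_right _ hab

theorem sqDist_congr {d p i k b : ℕ} {s s' : Mem} (h1 : s'.real 1 = s.real 1)
    (h2 : ∀ c < b * d, s'.real 2 c = s.real 2 c) (hi : i < b) (hk : k ≤ d) :
    sqDist s' d p i k = sqDist s d p i k := by
  refine Finset.sum_congr rfl fun j hj => ?_
  have := Finset.mem_range.1 hj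
  rw [h1, h2 _ (cell_lt (by omega) hi)]

/-- Later expansions write only to nodes numbered `b` or more, where `b` is the first new child;
`hi` places the parent `i` below its own children and hence below `b`. -/
theorem HasChildren.congr {d n i p b : ℕ} {s s' : Mem} (h : HasChildren d n s i p)
    (h1 : s'.real 1 = s.real 1) (h2 : ∀ c < b * d, s'.real 2 c = s.real 2 c)
    (h3 : ∀ c < b, s'.real 3 c = s.real 3 c) (hi : i ≤ i * n + p) (hb : 3 * (i * n + p) + 3 < b) :
    HasChildren d n s' i p := by
  obtain ⟨e1, e2, e3, e4⟩ := h
  have hib : i < b := by omega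
  unfold HasChildren
  rw [sqDist_congr h1 h2 hib le_rfl, h3 _ hib, h3 _ (by omega), h3 _ (by omega),
    h3 _ (by omega)]
  refine ⟨e1, e2, e3, fun j hj => ?_⟩
  rw [h1, h2 _ (cell_lt hj (by omega)), h2 _ (cell_lt hj (by omega)), h2 _ (cell_lt hj (by omega)),
    h2 _ (cell_lt hj (by omega))]
  exact e4 j hj

theorem runs_accLoop {d i p : ℕ} {s : Mem} (hd : s.nat 0 0 = d) (hi : s.nat 3 0 = i)
    (hp : s.nat 4 0 = p) (h4 : s.real 4 0 = 0) :
    Runs (forLoop 5 (.load 0 (.const 0)) accProg) s (d * 80 + 8) fun s' =>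
      (∀ a, a ≠ 5 → s'.nat a = s.nat a) ∧ (∀ a, a ≠ 4 → s'.real a = s.real a) ∧
      s'.real 4 0 = sqDist s d p i d := by
  refine (runs_forLoop (B := 64) d (fun k s' => s'.nat 5 0 = k ∧
      (∀ a, a ≠ 5 → s'.nat a = s.nat a) ∧ (∀ a, a ≠ 4 → s'.real a = s.real a) ∧
      s'.real 4 0 = sqDist s d p i k) (fun k s' h => h.1) (fun k s' h => ?_) ?_ ?_).mono ?_
      (fun s' h => h.2)
  · simp only [NExp.eval]; rw [h.2.1 0 (by decide), hd]
  · rintro k hk s' ⟨g1, g2, g3, g4⟩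
    unfold accProg
    refine (runs_setReal ?_).mono (by simp [coord, NExp.time, RExp.time]) fun _ h => h
    refine ⟨g1, by simp, fun a ha => ?_, fun a ha => ?_, ?_⟩
    · rw [Mem.writeNat_nat_of_ne _ _ _ ha, Mem.writeReal_nat, g2 a ha]
    · rw [Mem.writeNat_real, Mem.writeReal_real_of_ne _ _ _ ha, g3 a ha]
    · simp only [Mem.writeNat_real, NExp.eval, Mem.writeReal_real_self, RExp.eval, coord, g1, g4]
      rw [g2 0 (by decide), g2 3 (by decide), g2 4 (by decide), g3 1 (by decide), g3 2 (by decide),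
        hd, hi, hp, sqDist, sqDist, Finset.sum_range_succ]
      ring
  · exact ⟨by simp, fun a ha => by rw [Mem.writeNat_nat_of_ne _ _ _ ha], fun a ha => rfl,
      by simpa [sqDist] using h4⟩
  · simp only [NExp.time]; omega

theorem cell_ne {d j j' a a' : ℕ} (hj : j < d) (hj' : j' < d) (h : a = a' → j ≠ j') :
    a * d + j ≠ a' * d + j' := by
  intro e
  rcases lt_trichotomy a a' with h1 | rfl | h1
  · have := cell_lt hj h1; omega
  · exact h rfl (by omega)
  · have := cell_lt hj' h1; omega

/-- By `hip` the node `i` precedes its children, so writing them never destroys the coordinates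
being read. -/
theorem runs_writeLoop {d n i p : ℕ} {s : Mem} (hd : s.nat 0 0 = d) (hn : s.nat 0 1 = n)
    (hi : s.nat 3 0 = i) (hp : s.nat 4 0 = p) (hip : i ≤ i * n + p) :
    Runs (forLoop 5 (.load 0 (.const 0)) writeProg) s (d * 150 + 8) fun s' =>
      (∀ a, a ≠ 5 → s'.nat a = s.nat a) ∧ (∀ a, a ≠ 2 → s'.real a = s.real a) ∧
      (∀ c < (3 * (i * n + p) + 1) * d, s'.real 2 c = s.real 2 c) ∧
      ∀ j < d,
        s'.real 2 ((3 * (i * n + p) + 1) * d + j) = s.real 1 (p * d + j) ∧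
        s'.real 2 ((3 * (i * n + p) + 2) * d + j) = s.real 2 (i * d + j) ∧
        s'.real 2 ((3 * (i * n + p) + 3) * d + j) = s.real 2 (i * d + j)
          + s.real 3 i / s.real 4 0 * (s.real 1 (p * d + j) - s.real 2 (i * d + j)) := by
  refine (runs_forLoop (B := 130) d (fun k s' => s'.nat 5 0 = k ∧
      (∀ a, a ≠ 5 → s'.nat a = s.nat a) ∧ (∀ a, a ≠ 2 → s'.real a = s.real a) ∧
      (∀ c < (3 * (i * n + p) + 1) * d, s'.real 2 c = s.real 2 c) ∧
      ∀ j < k,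
        s'.real 2 ((3 * (i * n + p) + 1) * d + j) = s.real 1 (p * d + j) ∧
        s'.real 2 ((3 * (i * n + p) + 2) * d + j) = s.real 2 (i * d + j) ∧
        s'.real 2 ((3 * (i * n + p) + 3) * d + j) = s.real 2 (i * d + j)
          + s.real 3 i / s.real 4 0 * (s.real 1 (p * d + j) - s.real 2 (i * d + j)))
      (fun k s' h => h.1) (fun k s' h => ?_) ?_ ?_).mono ?_ (fun s' h => h.2)
  · simp only [NExp.eval]; rw [h.2.1 0 (by decide), hd]
  · rintro k hk s' ⟨g1, g2, g3, g4, g5⟩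
    unfold writeProg
    refine (runs_setReal_seq (runs_setReal_seq (runs_setReal ?_))).mono
      (by simp [coord, childNode, NExp.time, RExp.time]) fun _ h => h
    set q := i * n + p with hq
    have c1 : i * d + k ≠ (3 * q + 1) * d + k := cell_ne hk hk (by omega)
    have c2 : i * d + k ≠ (3 * q + 2) * d + k := cell_ne hk hk (by omega)
    have hold : s'.real 2 (i * d + k) = s.real 2 (i * d + k) := g4 _ (cell_lt hk (by omega))
    simp only [coord, childNode, NExp.eval, RExp.eval, Mem.writeReal_nat, g1,
      g2 0 (by decide), g2 3 (by decide), g2 4 (by decide), hd, hn, hi, hp, ← hq, zero_add,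
      Nat.reduceAdd, Mem.writeReal_real_of_ne _ _ _ (show 1 ≠ 2 by decide),
      Mem.writeReal_real_of_ne _ _ _ (show 3 ≠ 2 by decide),
      Mem.writeReal_real_of_ne _ _ _ (show 4 ≠ 2 by decide),
      g3 1 (by decide), g3 3 (by decide), g3 4 (by decide),
      Mem.writeReal_real_of_ne_cell _ _ _ c1, Mem.writeReal_real_of_ne_cell _ _ _ c2, hold]
    refine ⟨trivial, by simp, fun a ha => ?_, fun a ha => ?_, fun c hc => ?_, fun j hj => ?_⟩
    · rw [Mem.writeNat_nat_of_ne _ _ _ ha, Mem.writeReal_nat, Mem.writeReal_nat, Mem.writeReal_nat,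
        g2 a ha]
    · rw [Mem.writeNat_real, Mem.writeReal_real_of_ne _ _ _ ha, Mem.writeReal_real_of_ne _ _ _ ha,
        Mem.writeReal_real_of_ne _ _ _ ha, g3 a ha]
    · have e1 : (3 * q + 1) * d ≤ (3 * q + 2) * d := Nat.mul_le_mul_right _ (by omega)
      have e2 : (3 * q + 1) * d ≤ (3 * q + 3) * d := Nat.mul_le_mul_right _ (by omega)
      rw [Mem.writeNat_real, Mem.writeReal_real_of_ne_cell _ _ _ (by omega),
        Mem.writeReal_real_of_ne_cell _ _ _ (by omega),
        Mem.writeReal_real_of_ne_cell _ _ _ (by omega), g4 c hc]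
    · rw [Mem.writeNat_real]
      rcases Nat.lt_succ_iff_lt_or_eq.1 hj with hj | rfl
      · have hjd : j < d := by omega
        have hne : ∀ a b, a * d + j ≠ b * d + k := fun a b => cell_ne hjd hk (by omega)
        simp only [Mem.writeReal_real_of_ne_cell _ _ _ (hne _ _)]
        exact g5 j hj
      · have d12 : (3 * q + 1) * d + j ≠ (3 * q + 2) * d + j := cell_ne hk hk (by omega)
        have d13 : (3 * q + 1) * d + j ≠ (3 * q + 3) * d + j := cell_ne hk hk (by omega)
        have d23 : (3 * q + 2) * d + j ≠ (3 * q + 3) * d + j := cell_ne hk hk (by omega)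
        simp only [Mem.writeReal_real_of_ne_cell _ _ _ d12, Mem.writeReal_real_of_ne_cell _ _ _ d13,
          Mem.writeReal_real_of_ne_cell _ _ _ d23, Mem.writeReal_real_self, and_self]
  · exact ⟨by simp, fun a ha => by rw [Mem.writeNat_nat_of_ne _ _ _ ha], fun a ha => rfl,
      fun c hc => rfl, by simp⟩
  · simp only [NExp.time]; omega

theorem runs_childrenProg {d n i p : ℕ} {s : Mem} (hd : s.nat 0 0 = d) (hn : s.nat 0 1 = n)
    (hi : s.nat 3 0 = i) (hp : s.nat 4 0 = p) (hip : i ≤ i * n + p) :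
    Runs childrenProg s (d * 240 + 100) fun s' =>
      (∀ a, a ≠ 5 → s'.nat a = s.nat a) ∧ s'.real 1 = s.real 1 ∧
      (∀ c < (3 * (i * n + p) + 1) * d, s'.real 2 c = s.real 2 c) ∧
      (∀ c < 3 * (i * n + p) + 1, s'.real 3 c = s.real 3 c) ∧ HasChildren d n s' i p := by
  unfold childrenProg
  refine Runs.mono (runs_setReal_seq (Runs.seq (runs_accLoop (d := d) (i := i) (p := p)
    (by simpa using hd) (by simpa using hi) (by simpa using hp) (by simp [RExp.eval, NExp.eval]))
    fun s₁ hs₁ => runs_setReal_seq (runs_setReal_seq (runs_setReal_seq (runs_setReal_seq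
      ((runs_writeLoop (d := d) (n := n) (i := i) (p := p) ?_ ?_ ?_ ?_ hip).mono le_rfl
        fun s₂ hs₂ => ?_)))))) ?_ fun _ h => h
  · simp [hs₁.1, hd]
  · simp [hs₁.1, hn]
  · simp [hs₁.1, hi]
  · simp [hs₁.1, hp]
  · obtain ⟨a1, a2, a3⟩ := hs₁
    obtain ⟨b1, b2, b3, b4⟩ := hs₂
    simp only [Mem.writeReal_nat] at a1 b1
    set q := i * n + p with hq
    have hiq1 : i ≠ 3 * q + 1 := by omega
    have hiq2 : i ≠ 3 * q + 2 := by omega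
    have hiq3 : i ≠ 3 * q + 3 := by omega
    simp only [childNode, NExp.eval, RExp.eval, Mem.writeReal_nat, a1 0 (by decide),
      a1 3 (by decide), a1 4 (by decide), hn, hi, hp, ← hq, zero_add, Nat.reduceAdd,
      Mem.writeReal_real_self, Mem.writeReal_real_of_ne _ _ _ (show 1 ≠ 3 by decide),
      Mem.writeReal_real_of_ne _ _ _ (show 2 ≠ 3 by decide),
      Mem.writeReal_real_of_ne _ _ _ (show 4 ≠ 3 by decide),
      Mem.writeReal_real_of_ne _ _ _ (show 1 ≠ 4 by decide),
      Mem.writeReal_real_of_ne _ _ _ (show 2 ≠ 4 by decide),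
      Mem.writeReal_real_of_ne _ _ _ (show 3 ≠ 4 by decide),
      Mem.writeReal_real_of_ne_cell _ _ _ hiq1, Mem.writeReal_real_of_ne_cell _ _ _ hiq2,
      Mem.writeReal_real_of_ne_cell _ _ _ hiq3, a3] at b2 b3 b4
    have r1 : s₂.real 1 = s.real 1 := by
      rw [b2 1 (by decide)]
      simp only [Mem.writeReal_real_of_ne _ _ _ (show 1 ≠ 3 by decide),
        Mem.writeReal_real_of_ne _ _ _ (show 1 ≠ 4 by decide), a2 1 (by decide)]
    have r2 : s₁.real 2 = s.real 2 := by
      rw [a2 2 (by decide), Mem.writeReal_real_of_ne _ _ _ (by decide)]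
    have r2' : ∀ c < (3 * q + 1) * d, s₂.real 2 c = s.real 2 c := fun c hc => by rw [b3 c hc, r2]
    have r3 : s₁.real 3 = s.real 3 := by
      rw [a2 3 (by decide), Mem.writeReal_real_of_ne _ _ _ (by decide)]
    have r11 : s₁.real 1 = s.real 1 := by
      rw [a2 1 (by decide), Mem.writeReal_real_of_ne _ _ _ (by decide)]
    have sq1 : sqDist (s.writeReal 4 0 0) d p i d = sqDist s d p i d :=
      sqDist_congr (b := i + 1) (Mem.writeReal_real_of_ne _ _ _ (by decide))
        (fun c _ => by rw [Mem.writeReal_real_of_ne _ _ _ (by decide)]) (by omega) le_rfl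
    have sq2 : sqDist s₂ d p i d = sqDist s d p i d :=
      sqDist_congr (b := 3 * q + 1) r1 r2' (by omega) le_rfl
    have r3' : ∀ c < 3 * q + 1, s₂.real 3 c = s.real 3 c := fun c hc => by
      rw [b2 3 (by decide), Mem.writeReal_real_of_ne_cell _ _ _ (by omega),
        Mem.writeReal_real_of_ne_cell _ _ _ (by omega),
        Mem.writeReal_real_of_ne_cell _ _ _ (by omega),
        Mem.writeReal_real_of_ne _ _ _ (by decide), r3]
    refine ⟨fun a ha => ?_, r1, r2', r3', ?_⟩
    · rw [b1 a ha, a1 a ha]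
    · unfold HasChildren
      rw [sq2, ← hq]
      rw [r3' i (by omega)]
      simp only [Nat.cast_zero, sq1, r3, r2, r11] at b2 b4
      refine ⟨?_, ?_, ?_, fun j hj => ?_⟩
      · rw [b2 3 (by decide), Mem.writeReal_real_of_ne_cell _ _ _ (by omega),
          Mem.writeReal_real_of_ne_cell _ _ _ (by omega), Mem.writeReal_real_self]
      · rw [b2 3 (by decide), Mem.writeReal_real_of_ne_cell _ _ _ (by omega),
          Mem.writeReal_real_self, Nat.cast_ofNat]
      · rw [b2 3 (by decide), Mem.writeReal_real_self]
      · rw [r1, r2' _ (cell_lt hj (show i < 3 * q + 1 by omega))]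
        exact b4 j hj
  · simp [childNode, NExp.time, RExp.time]; omega

/-- All nodes that precede `(i, p)` have been expanded. -/
def Expanded (d n : ℕ) (s : Mem) (i p : ℕ) : Prop :=
  ∀ i' p', p' < n → i' * n + p' < i * n + p → HasChildren d n s i' p'

theorem runs_expandInner {d n i : ℕ} {s : Mem} (hd : s.nat 0 0 = d) (hn : s.nat 0 1 = n)
    (hi : s.nat 3 0 = i) (hs : Expanded d n s i 0) :
    Runs (forLoop 4 (.load 0 (.const 1)) childrenProg) s (n * (d * 240 + 111) + 8) fun s' =>
      (∀ a, a ≠ 4 → a ≠ 5 → s'.nat a = s.nat a) ∧ s'.real 1 = s.real 1 ∧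
      Expanded d n s' (i + 1) 0 := by
  refine (runs_forLoop (B := d * 240 + 100) n (fun k s' => s'.nat 4 0 = k ∧
      (∀ a, a ≠ 4 → a ≠ 5 → s'.nat a = s.nat a) ∧ s'.real 1 = s.real 1 ∧ Expanded d n s' i k)
      (fun k s' h => h.1) (fun k s' h => ?_) ?_ ?_).mono ?_ ?_
  · simp only [NExp.eval]; rw [h.2.1 0 (by decide) (by decide), hn]
  · rintro k hk s' ⟨g1, g2, g3, g4⟩
    have hle : ∀ a b, b < n → a ≤ a * n + b := fun a b hb =>
      (Nat.le_mul_of_pos_right a (by omega)).trans (Nat.le_add_right _ _)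
    refine (runs_childrenProg (d := d) (n := n) (i := i) (p := k)
      (by rw [g2 0 (by decide) (by decide), hd]) (by rw [g2 0 (by decide) (by decide), hn])
      (by rw [g2 3 (by decide) (by decide), hi]) g1 (hle _ _ hk)).mono le_rfl ?_
    rintro s'' ⟨f1, f2, f3, f4, f5⟩
    refine ⟨by rw [f1 4 (by decide), g1], by simp, fun a ha ha' => ?_, ?_, fun i' p' hp' hlt => ?_⟩
    · rw [Mem.writeNat_nat_of_ne _ _ _ ha, f1 a ha', g2 a ha ha']
    · rw [Mem.writeNat_real, f2, g3]
    · change HasChildren d n s'' i' p'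
      rcases Nat.lt_or_ge (i' * n + p') (i * n + k) with h | h
      · exact (g4 i' p' hp' h).congr f2 f3 f4 (hle _ _ hp') (by omega)
      · by_cases he : i' = i
        · subst he
          obtain rfl : p' = k := by omega
          exact f5
        -- The pair `(i', p')` is determined by `i' * n + p'`, by uniqueness of division with
        -- remainder.
        · exact absurd (show i' * n + p' = i * n + k by omega) (cell_ne hp' hk (fun h => absurd h he))
  · exact ⟨by simp, fun a ha _ => by rw [Mem.writeNat_nat_of_ne _ _ _ ha], rfl, hs⟩
  · simp only [NExp.time]
    rw [show d * 240 + 100 + (1 + 1) + 9 = d * 240 + 111 by ring]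
  · rintro s' ⟨-, h1, h2, h3⟩
    exact ⟨h1, h2, fun i' p' hp' hlt => h3 i' p' hp' (by rw [Nat.add_mul] at hlt; omega)⟩

theorem runs_expandProg {d n M : ℕ} {s : Mem} (hd : s.nat 0 0 = d) (hn : s.nat 0 1 = n)
    (hM : s.nat 1 0 = M) :
    Runs expandProg s (M * (n * (d * 240 + 111) + 19) + 8) fun s' =>
      s'.nat 1 0 = M ∧ s'.real 1 = s.real 1 ∧ ∀ i < M, ∀ p < n, HasChildren d n s' i p := by
  refine (runs_forLoop (B := n * (d * 240 + 111) + 8) M (fun k s' => s'.nat 3 0 = k ∧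
      (∀ a, a < 3 → s'.nat a = s.nat a) ∧ s'.real 1 = s.real 1 ∧ Expanded d n s' k 0)
      (fun k s' h => h.1) (fun k s' h => ?_) ?_ ?_).mono ?_ ?_
  · simp only [NExp.eval]; rw [h.2.1 1 (by decide), hM]
  · rintro k hk s' ⟨g1, g2, g3, g4⟩
    refine (runs_expandInner (d := d) (n := n) (i := k) (by rw [g2 0 (by decide), hd])
      (by rw [g2 0 (by decide), hn]) g1 g4).mono le_rfl ?_
    rintro s'' ⟨f1, f2, f3⟩
    refine ⟨by rw [f1 3 (by decide) (by decide), g1], by simp, fun a ha => ?_, ?_, f3⟩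
    · rw [Mem.writeNat_nat_of_ne _ _ _ (by omega), f1 a (by omega) (by omega), g2 a ha]
    · rw [Mem.writeNat_real, f2, g3]
  · refine ⟨by simp, fun a ha => by rw [Mem.writeNat_nat_of_ne _ _ _ (by omega)], rfl, ?_⟩
    intro i' p' _ h; omega
  · simp only [NExp.time]
    rw [show n * (d * 240 + 111) + 8 + (1 + 1) + 9 = n * (d * 240 + 111) + 19 by ring]
  · rintro s' ⟨-, h1, h2, h3⟩
    refine ⟨by rw [h1 1 (by decide), hM], h2, fun i hi p hp => h3 i p hp ?_⟩
    calc i * n + p < M * n := cell_lt hp hi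
      _ = _ := by ring

theorem runs_depthProg {n z : ℕ} {ε : ℝ} (hε : 0 < ε) {s : Mem} (hn : s.nat 0 1 = n)
    (hz : s.nat 0 2 = z) (hK : s.nat 2 0 = 0) (he : s.real 0 0 = ε) :
    Runs depthProg s (⌈2304 * z ^ 2 / ε ^ 2⌉₊ * 50 + 30) fun s' =>
      s'.nat 0 = s.nat 0 ∧ s'.real = s.real ∧
      s'.nat 1 0 = (3 * n + 1) ^ ⌈2304 * z ^ 2 / ε ^ 2⌉₊ := by
  have htest : ∀ k : ℕ, (k : ℝ) * (ε * ε) < (2304 : ℕ) * ((z : ℝ) * z)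
      ↔ k < ⌈2304 * (z : ℝ) ^ 2 / ε ^ 2⌉₊ := by
    intro k
    rw [Nat.lt_ceil, lt_div_iff₀ (by positivity), pow_two, pow_two, Nat.cast_ofNat]
  unfold depthProg
  refine Runs.mono (runs_setNat_seq ((runs_loop (B := 20) ⌈2304 * (z : ℝ) ^ 2 / ε ^ 2⌉₊
    (fun k s' => s'.nat 0 = s.nat 0 ∧ s'.real = s.real ∧ s'.nat 2 0 = k ∧
      s'.nat 1 0 = (3 * n + 1) ^ k) ?_ ?_ ?_ ?_).mono le_rfl
        fun s' h => ⟨h.1, h.2.1, h.2.2.2⟩)) ?_ fun _ h => h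
  · rintro k hk s' ⟨g1, g2, g3, g4⟩
    simpa only [Test.holds, RExp.eval, NExp.eval, g1, g2, g3, hz, he, htest] using hk
  · rintro s' ⟨g1, g2, g3, g4⟩
    simp only [Test.holds, RExp.eval, NExp.eval, g1, g2, g3, hz, he, htest]
    exact lt_irrefl _
  · rintro k hk s' ⟨g1, g2, g3, g4⟩
    refine (runs_setNat_seq (runs_setNat ?_)).mono (by simp [NExp.time]) fun _ h => h
    refine ⟨?_, by simp [g2], ?_, ?_⟩
    · rw [Mem.writeNat_nat_of_ne _ _ _ (by decide), Mem.writeNat_nat_of_ne _ _ _ (by decide), g1]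
    · rw [Mem.writeNat_nat_of_ne _ _ _ (by decide)]
      simp [NExp.eval, g3]
    · simp only [NExp.eval, Mem.writeNat_nat_self, Mem.writeNat_nat_of_ne _ _ _ (show 1 ≠ 2 by decide),
        Mem.writeNat_nat_of_ne _ _ _ (show 0 ≠ 2 by decide), g4, g1, hn, pow_succ]
  · refine ⟨Mem.writeNat_nat_of_ne _ _ _ (by decide), rfl, ?_, by simp [NExp.eval]⟩
    rw [Mem.writeNat_nat_of_ne _ _ _ (by decide), hK]
  · simp [NExp.time, RExp.time, Test.time]; omega

theorem runs_netProg {d n z : ℕ} {ε : ℝ} (hε : 0 < ε) {s : Mem} (hd : s.nat 0 0 = d)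
    (hn : s.nat 0 1 = n) (hz : s.nat 0 2 = z) (hK : s.nat 2 0 = 0) (he : s.real 0 0 = ε) :
    Runs netProg s (⌈2304 * z ^ 2 / ε ^ 2⌉₊ * 50 + 30 +
        ((3 * n + 1) ^ ⌈2304 * z ^ 2 / ε ^ 2⌉₊ * (n * (d * 240 + 111) + 19) + 8)) fun s' =>
      s'.nat 1 0 = (3 * n + 1) ^ ⌈2304 * z ^ 2 / ε ^ 2⌉₊ ∧ s'.real 1 = s.real 1 ∧
      ∀ i < (3 * n + 1) ^ ⌈2304 * z ^ 2 / ε ^ 2⌉₊, ∀ p < n, HasChildren d n s' i p := by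
  refine (runs_depthProg hε hn hz hK he).seq fun s₁ hs₁ => ?_
  refine (runs_expandProg (d := d) (by rw [hs₁.1, hd]) (by rw [hs₁.1, hn]) hs₁.2.2).mono le_rfl ?_
  rintro s₂ ⟨h1, h2, h3⟩
  exact ⟨h1, by rw [h2, hs₁.2.1], h3⟩

end Clustering

namespace Clustering

open RealRAM

/-! ## The output of the program -/

/-- The point number `i` that a memory represents. -/
def nodePoint (d : ℕ) (s : Mem) (i : ℕ) : E d := WithLp.toLp 2 fun j => s.real 2 (i * d + j)

theorem outputSet_eq (d : ℕ) (s : Mem) :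
    outputSet d s = nodePoint d s '' (Finset.range (s.nat 1 0) : Set ℕ) := by
  ext x
  simp only [outputSet, Set.mem_ofPred_eq, Set.mem_image, Finset.coe_range, Set.mem_Iio]
  refine exists_congr fun i => and_congr_right fun _ => ⟨fun h => ?_, fun h j => ?_⟩
  · ext j; exact (h j).symm
  · rw [← h]; rfl

theorem outputSet_finite (d : ℕ) (s : Mem) : (outputSet d s).Finite := by
  rw [outputSet_eq]; exact (Finset.finite_toSet _).image _

theorem ncard_outputSet_le (d : ℕ) (s : Mem) : (outputSet d s).ncard ≤ s.nat 1 0 := by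
  rw [outputSet_eq]
  refine (Set.ncard_image_le (Finset.finite_toSet _)).trans ?_
  rw [Set.ncard_coe_finset, Finset.card_range]

theorem inputMem_point {d z : ℕ} {ε : ℝ} {L : List (E d)} {p : ℕ} (hp : p < L.length) (j : Fin d) :
    (inputMem z ε L).real 1 (p * d + j) = L.get ⟨p, hp⟩ j := by
  have hd : 0 < d := j.pos
  have h1 : (p * d + j) / d = p := by
    rw [mul_comm, Nat.mul_add_div hd, Nat.div_eq_of_lt j.2, add_zero]
  have h2 : (p * d + j) % d = j := by
    rw [mul_comm, Nat.mul_add_mod, Nat.mod_eq_of_lt j.2]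
  simp only [inputMem, one_ne_zero, if_false, if_true, h1, h2]
  rw [dif_pos ⟨hp, hd⟩]

/-- A step towards a point at distance `0` needs no separate case: division by zero gives `0` both
in the program and in `IsTree`. -/
theorem isTree_of_hasChildren {d M : ℕ} {L : List (E d)} {s : Mem}
    (hin : ∀ (p : ℕ) (hp : p < L.length) (j : Fin d), s.real 1 (p * d + j) = L.get ⟨p, hp⟩ j)
    (h : ∀ i < M, ∀ p < L.length, HasChildren d L.length s i p) :
    IsTree L M (nodePoint d s) (s.real 3) := by
  intro i hi p hp
  obtain ⟨h1, h2, h3, h4⟩ := h i hi p hp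
  have hdist : Real.sqrt (sqDist s d p i d) = dist (L.get ⟨p, hp⟩) (nodePoint d s i) := by
    rw [EuclideanSpace.dist_eq, sqDist, Finset.sum_range]
    congr 1
    refine Finset.sum_congr rfl fun j _ => ?_
    rw [Real.dist_eq, sq_abs, hin p hp]; rfl
  rw [hdist] at h1 h4
  refine ⟨?_, h1, ?_, h2, ?_, h3⟩
  · ext j
    exact (h4 j j.2).1.trans (hin p hp j)
  · ext j
    exact (h4 j j.2).2.1
  · ext j
    refine (h4 j j.2).2.2.trans ?_
    rw [hin p hp]; rfl

/-! ### Bounds for size, time and depth, and the net property of the output -/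

theorem net_size_le {T n K : ℕ} (hT : 2 ≤ T) (hn : n ≤ T) : (3 * n + 1) ^ K ≤ T ^ (4 * K) := by
  rw [pow_mul]
  refine Nat.pow_le_pow_left ?_ K
  calc 3 * n + 1 ≤ 8 * T := by omega
    _ = 2 ^ 3 * T := by norm_num
    _ ≤ T ^ 3 * T := Nat.mul_le_mul_right _ (Nat.pow_le_pow_left hT 3)
    _ = T ^ 4 := by ring

theorem net_time_le {T n d K : ℕ} (hT : 2 ≤ T) (hn : n ≤ T) :
    K * 50 + 30 + ((3 * n + 1) ^ K * (n * (d * 240 + 111) + 19) + 8)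
      ≤ (d + 1) * T ^ (4 * K + 10) := by
  have hM := net_size_le (K := K) hT hn
  have hK : K ≤ T ^ (4 * K) :=
    (Nat.lt_two_pow_self).le.trans ((Nat.pow_le_pow_left hT K).trans
      (Nat.pow_le_pow_right (by omega) (by omega)))
  have h1 : 1 ≤ T ^ (4 * K) := Nat.one_le_pow _ _ (by omega)
  set W := T ^ (4 * K)
  have h2 : n * (d * 240 + 111) + 19 ≤ (d + 1) * (250 * T) := by
    have : n * (d * 240 + 111) ≤ T * (d * 240 + 111) := Nat.mul_le_mul_right _ hn
    nlinarith
  calc K * 50 + 30 + ((3 * n + 1) ^ K * (n * (d * 240 + 111) + 19) + 8)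
      ≤ W * 50 + 30 + (W * ((d + 1) * (250 * T)) + 8) := by gcongr
    _ ≤ W * 88 + W * ((d + 1) * (250 * T)) := by omega
    _ ≤ W * ((d + 1) * (88 * T)) + W * ((d + 1) * (250 * T)) := by
        gcongr; nlinarith
    _ = (d + 1) * (W * (338 * T)) := by ring
    -- `338 ≤ 2 ^ 9 ≤ T ^ 9`: constants become powers of `T` because `T ≥ 2`.
    _ ≤ (d + 1) * (W * (T ^ 9 * T)) := by
        gcongr
        exact le_trans (by norm_num) (Nat.pow_le_pow_left hT 9)
    _ = (d + 1) * T ^ (4 * K + 10) := by rw [pow_add]; ring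

theorem depth_le {z : ℕ} {ε : ℝ} (hz : 1 ≤ z) (h0 : 0 < ε) (h1 : ε < 1) :
    ((4 * ⌈2304 * (z : ℝ) ^ 2 / ε ^ 2⌉₊ + 10 : ℕ) : ℝ) ≤ ((40000 : ℕ) : ℝ) ^ z / ε ^ 2 := by
  have hz' : (1 : ℝ) ≤ (z : ℝ) ^ 2 := one_le_pow₀ (by exact_mod_cast hz)
  have hc := Nat.ceil_lt_add_one (show 0 ≤ 2304 * (z : ℝ) ^ 2 / ε ^ 2 by positivity)
  have hε : ε ^ 2 ≤ 1 := pow_le_one₀ h0.le h1.le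
  have hone : 1 ≤ (z : ℝ) ^ 2 / ε ^ 2 := by rw [le_div_iff₀ (by positivity)]; linarith
  have e : 2304 * (z : ℝ) ^ 2 / ε ^ 2 = 2304 * ((z : ℝ) ^ 2 / ε ^ 2) := by ring
  have hz2 : (z : ℝ) ^ 2 ≤ 4 ^ z := by
    have : (z : ℝ) ≤ 2 ^ z := by exact_mod_cast (Nat.lt_two_pow_self).le
    calc (z : ℝ) ^ 2 ≤ (2 ^ z) ^ 2 := by gcongr
      _ = 4 ^ z := by rw [← pow_mul, mul_comm, pow_mul]; norm_num
  -- Rounding and additive constants are absorbed by `z ^ 2 / ε ^ 2 ≥ 1`, and `z ^ 2 ≤ 4 ^ z` turns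
  -- the bound into the form `A ^ z`.
  calc ((4 * ⌈2304 * (z : ℝ) ^ 2 / ε ^ 2⌉₊ + 10 : ℕ) : ℝ)
      ≤ 10000 * ((z : ℝ) ^ 2 / ε ^ 2) := by push_cast; linarith
    _ ≤ 10000 ^ z * (4 ^ z / ε ^ 2) := by
        gcongr
        exact le_self_pow₀ (by norm_num) (by omega)
    _ = ((40000 : ℕ) : ℝ) ^ z / ε ^ 2 := by rw [← mul_div_assoc, ← mul_pow]; norm_num

theorem outputSet_isNet {d z : ℕ} {ε : ℝ} (hz : 1 ≤ z) (h0 : 0 < ε) (h1 : ε < 1)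
    {L : List (E d)} {s : Mem}
    (hM : s.nat 1 0 = (3 * L.length + 1) ^ ⌈2304 * (z : ℝ) ^ 2 / ε ^ 2⌉₊)
    (htree : IsTree L (s.nat 1 0) (nodePoint d s) (s.real 3)) :
    (∀ p ∈ L, p ∈ outputSet d s) ∧
      ∀ c : E d, ∃ x ∈ outputSet d s, ∀ p ∈ L, dist p x ≤ (1 + ε / (16 * z)) * dist p c := by
  have hz' : (1 : ℝ) ≤ z := by exact_mod_cast hz
  set K := ⌈2304 * (z : ℝ) ^ 2 / ε ^ 2⌉₊ with hK
  have hceil : 2304 * (z : ℝ) ^ 2 / ε ^ 2 ≤ K := Nat.le_ceil _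
  rw [hM] at htree
  have hmem : ∀ {t y e}, Reach L (nodePoint d s 0) (s.real 3 0) t y e → t ≤ K →
      y ∈ outputSet d s := by
    intro t y e hr ht
    obtain ⟨i, hi, rfl, -⟩ := htree.exists_index hr ht
    rw [outputSet_eq, hM]
    exact ⟨i, by simpa using hi.trans_le (Nat.pow_le_pow_right (by omega) ht), rfl⟩
  constructor
  · intro p hp
    refine hmem (Reach.root.jump hp) ?_
    have : 0 < K := Nat.ceil_pos.2 (by positivity)
    omega
  · intro c
    -- For `δ = ε / (16 z)` the required depth `9 / δ ^ 2` is exactly `2304 z ^ 2 / ε ^ 2`.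
    obtain ⟨t, ht, x, e, hr, hx⟩ := exists_reach_dist_le (L := L) (x₀ := nodePoint d s 0)
      (e₀ := s.real 3 0) (δ := ε / (16 * z)) (by positivity)
      (by rw [div_lt_one (by positivity)]; linarith) (K := K)
      (le_trans (le_of_eq (by field_simp; norm_num)) hceil) c
    exact ⟨x, hmem hr ht, hx⟩

end Clustering

theorem mainTheorem9 :
    ∃ (prog : RealRAM.Prog) (A : ℕ),
      ∀ (T d z : ℕ) (ε : ℝ), 2 ≤ T → 1 ≤ z → 0 < ε → ε < 1 →
      ∀ (P : Multiset (Clustering.E d)) (L : List (Clustering.E d)),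
        Clustering.IsListing L P → L.length ≤ T →
        ∃ (t : ℕ) (s : RealRAM.Mem),
          RealRAM.Exec prog (Clustering.inputMem z ε L) t s ∧
          (t : ℝ) ≤ ((d : ℝ) + 1) * (T : ℝ) ^ ((A : ℝ) ^ z / ε ^ 2) ∧
          (Clustering.outputSet d s).Finite ∧
          ((Clustering.outputSet d s).ncard : ℝ) ≤ (T : ℝ) ^ ((A : ℝ) ^ z / ε ^ 2) ∧
          ∀ (m : ℕ) (Φ : Clustering.E d →ₗ[ℝ] Clustering.E m),
            Clustering.PreservesDist Φ (Clustering.outputSet d s) (ε / z) →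
            ∀ P' : Multiset (Clustering.EExt d), Clustering.IsExtension P P' →
            ∀ C' : Multiset (Clustering.EExt d), C' ≤ P' →
              (∃ c, Clustering.IsCenterZero z C' c) ∧
              (∃ c, Clustering.IsCenterZero z (Clustering.mapExt Φ C') c) ∧
              ∀ (c : Clustering.EExt d) (cΦ : Clustering.EExt m),
                Clustering.IsCenterZero z C' c →
                Clustering.IsCenterZero z (Clustering.mapExt Φ C') cΦ →
                (1 - 2 * ε) * Clustering.cost z C' c
                    ≤ Clustering.cost z (Clustering.mapExt Φ C') cΦ ∧
                Clustering.cost z (Clustering.mapExt Φ C') cΦ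
                    ≤ (1 + 2 * ε) * Clustering.cost z C' c := by
  refine ⟨Clustering.netProg, 40000, fun T d z ε hT hz h0 h1 P L hL hLT => ?_⟩
  obtain ⟨t, s, hexec, ht, hM, hin, hchild⟩ := Clustering.runs_netProg (d := d) (n := L.length)
    (z := z) h0 (s := Clustering.inputMem z ε L) rfl rfl rfl rfl rfl
  have hnet := Clustering.outputSet_isNet hz h0 h1 hM (Clustering.isTree_of_hasChildren
    (fun p hp j => by rw [hin]; exact Clustering.inputMem_point hp j) (hM ▸ hchild))
  have hT1 : (1 : ℝ) ≤ T := by exact_mod_cast (by omega : 1 ≤ T)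
  have hpow : ((T ^ (4 * ⌈2304 * (z : ℝ) ^ 2 / ε ^ 2⌉₊ + 10) : ℕ) : ℝ)
      ≤ (T : ℝ) ^ (((40000 : ℕ) : ℝ) ^ z / ε ^ 2) := by
    rw [Nat.cast_pow, ← Real.rpow_natCast]
    exact Real.rpow_le_rpow_of_exponent_le hT1 (Clustering.depth_le hz h0 h1)
  refine ⟨t, s, hexec, ?_, Clustering.outputSet_finite d s, ?_, ?_⟩
  · have : (t : ℝ) ≤ ((d + 1) * T ^ (4 * ⌈2304 * (z : ℝ) ^ 2 / ε ^ 2⌉₊ + 10) : ℕ) := by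
      exact_mod_cast ht.trans (Clustering.net_time_le hT hLT)
    refine this.trans ?_
    rw [Nat.cast_mul, Nat.cast_add, Nat.cast_one]
    exact mul_le_mul_of_nonneg_left hpow (by positivity)
  · refine le_trans ?_ hpow
    refine Nat.cast_le.2 ((Clustering.ncard_outputSet_le d s).trans ?_)
    rw [hM]
    exact (Clustering.net_size_le hT hLT).trans (Nat.pow_le_pow_right (by omega) (by omega))
  · intro m Φ hΦ P' hP' C' hC'
    refine ⟨Clustering.exists_isCenterZero hz _, Clustering.exists_isCenterZero hz _,
      fun c cΦ hc hcΦ => Clustering.cost_preserved hz h0 h1 hnet.1 hnet.2 hΦ ?_ hc hcΦ⟩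
    intro x hx
    rw [hL.2, ← hP']
    exact Multiset.mem_map_of_mem _ (Multiset.mem_of_le hC' hx)
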